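/- Let $k$ be a field (of any characteristic) and let $A$ be a quaternion algebra over $k$, i.e. a four-dimensional central simple associative $k$-algebra, with its norm $n$ (the multiplicative quadratic form on $A$ whose polar form $\langle x,y\rangle=n(x+y)-n(x)-n(y)$ is non-degenerate) and its canonical involution $\kappa(x)=\bar x=\langle x,1\rangle 1-x$. Write $L_a(x)=ax$, $R_a(x)=xa$ and $c_s=L_sR_s^{-1}$ for $a,s\in A^*$. Let $GO(A)$ be the group of similitudes of $(A,n)$, i.e. of $\varphi\in GL(A)$ with $n(\varphi(x))=\mu(\varphi)n(x)$ for all $x$, for some $\mu(\varphi)\in k^*$; let $GO^{+}(A)=GO^{+1}(A)$ be the subgroup of proper similitudes (those with $\det\varphi=\mu(\varphi)^{2}$ if $\operatorname{char}k\neq2$, and those with Dickson invariant zero if $\operatorname{char}k=2$), and $GO^{-1}(A)=GO(A)\setminus GO^{+}(A)$. Let $PGL(A)=GL(A)/k^*\mathrm{I}$, and let $PGO^{i}(A)\subset PGL(A)$ be the image of $GO^{i}(A)$, $i=\pm1$; write $PGO^+(A)=PGO^{+1}(A)$. Linear maps are identified with their classes in $PGL(A)$. Let $X_A=PGL(A)^2/A^*$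 be the set of orbits of the action $w\cdot(\alpha,\beta)=(R_w^{-1}\alpha,\,L_w\beta)$ of $A^*$ on $PGL(A)^2$. The group $PGO^{+}(A)$ acts on $X_A$ by $\varphi\cdot(\alpha,\beta)=(\varphi_1\alpha\varphi^{-1},\varphi_2\beta\varphi^{-1})$, where $\varphi_1,\varphi_2\in GO(A)$ are triality components of $\varphi$, that is, $\varphi(xy)=\varphi_1(x)\varphi_2(y)$ for all $x,y\in A$. The groupoid of an action of a group $G$ on a set has the elements of the set as objects and the $g\in G$ with $g\cdot x=y$ as morphisms $x\to y$. Let $\mathscr X(A)$ be the groupoid of the action of $PGO^+(A)$ on $X_A$ and, for $i,j\in\{1,-1\}$, let $\mathscr X^{c(i,j)}(A)$ be its full subcategory with object set $(PGO^{i}(A)\times PGO^{j}(A))/A^*\subset X_A$. Then each of the four categories $\mathscr X^{c(i,j)}(A)$ is equivalent to the groupoid $\mathscr Z^c(A)$ of the action $s\cdot(a,b)=(sas^{-1},sbs^{-1})$ of $A^*/k^*$ on $(A^*/k^*)^2$. More precisely, there are equivalences of categories $\mathscr H^c_{i,j}:\mathscr Z^c(A)\to\mathscr X^{c(i,j)}(A)$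 given by $\mathscr H^c_{i,j}(s)=c_s$ on morphisms and, on objects, by $$\mathscr H^c_{1,1}(a,b)=(L_a,R_b),\qquad \mathscr H^c_{-1,1}(a,b)=(R_a\kappa,R_b),$$ $$\mathscr H^c_{1,-1}(a,b)=(L_a,L_b\kappa),\qquad \mathscr H^c_{-1,-1}(a,b)=(L_a\kappa,R_b\kappa).$$ -/

import Mathlib

open CategoryTheory

noncomputable section

namespace QuatComp

universe u v

/-! ## Quadratic spaces: similitudes and proper similitudes -/

section QuadraticSpace

variable {k : Type u} {V : Type v} [Field k] [AddCommGroup V] [Module k V]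

/-- `g` is a similitude of the quadratic space `(V, q)` with multiplier `μ`. -/
def HasMultiplier (q : QuadraticForm k V) (g : V ≃ₗ[k] V) (μ : kˣ) : Prop :=
  ∀ x, q (g x) = μ * q x

/-- The vanishing of the Dickson invariant of a similitude `g` with multiplier `μ`, over a field of
characteristic two.  If a bilinear form `M` satisfies `M x x = q x`, then `M (g x) (g y)` and
`μ * M x y` have the same diagonal, so (the polar form `b` of `q` being non-degenerate)
`M (g x) (g y) - μ * M x y = b x (ρ y) - b y (ρ x)` for some endomorphism `ρ`;
the Dickson invariant of `g` is `μ⁻¹ * trace ρ`, an element of `{0, 1}` that depends neither on `M`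
nor on `ρ`.  In matrices: `Gᵀ M G = μ M + R - Rᵀ`, `ρ = (M + Mᵀ)⁻¹ R`. -/
def DicksonVanishes (q : QuadraticForm k V) (g : V ≃ₗ[k] V) (μ : kˣ) : Prop :=
  ∀ M : V →ₗ[k] V →ₗ[k] k, (∀ x, M x x = q x) →
    ∃ ρ : V →ₗ[k] V,
      (∀ x y, M (g x) (g y) =
        μ * M x y + (QuadraticMap.polar q x (ρ y) - QuadraticMap.polar q y (ρ x))) ∧
      LinearMap.trace k V ρ = 0

/-- `g` is a proper similitude with multiplier `μ` of the (even-dimensional) quadratic space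
`(V, q)`: `det g = μ ^ (dim V / 2)` if `char k ≠ 2`, and the Dickson invariant of `g` is zero if
`char k = 2`. -/
def IsProperWith (q : QuadraticForm k V) (g : V ≃ₗ[k] V) (μ : kˣ) : Prop :=
  HasMultiplier q g μ ∧
    ((2 : k) ≠ 0 → LinearMap.det (g : V →ₗ[k] V) = (μ : k) ^ (Module.finrank k V / 2)) ∧
    ((2 : k) = 0 → DicksonVanishes q g μ)

lemma HasMultiplier.polar {q : QuadraticForm k V} {g : V ≃ₗ[k] V} {μ : kˣ}
    (h : HasMultiplier q g μ) (x y : V) :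
    QuadraticMap.polar q (g x) (g y) = μ * QuadraticMap.polar q x y := by
  simp only [QuadraticMap.polar, ← map_add, h _]
  ring

lemma HasMultiplier.mul {q : QuadraticForm k V} {g h : V ≃ₗ[k] V} {μ ν : kˣ}
    (hg : HasMultiplier q g μ) (hh : HasMultiplier q h ν) : HasMultiplier q (g * h) (μ * ν) := by
  intro x
  rw [LinearEquiv.mul_apply, hg, hh, Units.val_mul, mul_assoc]

lemma HasMultiplier.inv {q : QuadraticForm k V} {g : V ≃ₗ[k] V} {μ : kˣ}
    (hg : HasMultiplier q g μ) : HasMultiplier q g⁻¹ μ⁻¹ := by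
  intro x
  have h := hg (g⁻¹ x)
  rw [← LinearEquiv.mul_apply, mul_inv_cancel, LinearEquiv.coe_one, id] at h
  rw [h, Units.inv_mul_cancel_left]

lemma HasMultiplier.one (q : QuadraticForm k V) : HasMultiplier q (1 : V ≃ₗ[k] V) 1 := by
  intro x
  simp

lemma trace_conj_inv (g : V ≃ₗ[k] V) (ρ : V →ₗ[k] V) :
    LinearMap.trace k V ((g : V →ₗ[k] V) ∘ₗ ρ ∘ₗ ((g⁻¹ : V ≃ₗ[k] V) : V →ₗ[k] V)) =
      LinearMap.trace k V ρ := by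
  exact LinearMap.trace_conj' ρ g

lemma IsProperWith.one (q : QuadraticForm k V) : IsProperWith q (1 : V ≃ₗ[k] V) 1 := by
  refine ⟨HasMultiplier.one q, fun _ => ?_, fun _ M _ => ⟨0, ?_, map_zero _⟩⟩
  · simp
  · intro x y
    simp [QuadraticMap.polar_zero_right]

lemma IsProperWith.mul {q : QuadraticForm k V} {g h : V ≃ₗ[k] V} {μ ν : kˣ}
    (hg : IsProperWith q g μ) (hh : IsProperWith q h ν) : IsProperWith q (g * h) (μ * ν) := by
  refine ⟨hg.1.mul hh.1, fun h2 => ?_, fun h2 M hM => ?_⟩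
  · have e : ((g * h : V ≃ₗ[k] V) : V →ₗ[k] V) = (g : V →ₗ[k] V) * (h : V →ₗ[k] V) := rfl
    rw [e, map_mul, hg.2.1 h2, hh.2.1 h2, Units.val_mul, mul_pow]
  · obtain ⟨ρ, hρ, tρ⟩ := hg.2.2 h2 M hM
    obtain ⟨σ, hσ, tσ⟩ := hh.2.2 h2 M hM
    refine ⟨(μ : k) • σ + (ν : k) •
      (((h⁻¹ : V ≃ₗ[k] V) : V →ₗ[k] V) ∘ₗ ρ ∘ₗ (h : V →ₗ[k] V)), ?_, ?_⟩
    · intro x y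
      have key : ∀ x y, QuadraticMap.polar q (h x) (ρ (h y)) =
          ν * QuadraticMap.polar q x (h⁻¹ (ρ (h y))) := by
        intro x y
        rw [← hh.1.polar, ← LinearEquiv.mul_apply h h⁻¹, mul_inv_cancel]
        rfl
      simp only [LinearEquiv.mul_apply, LinearMap.add_apply, LinearMap.smul_apply,
        LinearMap.comp_apply, LinearEquiv.coe_coe, QuadraticMap.polar_add_right,
        QuadraticMap.polar_smul_right, smul_eq_mul, Units.val_mul, hρ, hσ, key]
      ring
    · have := trace_conj_inv h⁻¹ ρ
      rw [inv_inv] at this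
      rw [map_add, map_smul, map_smul, this, tρ, tσ]
      simp

lemma IsProperWith.inv {q : QuadraticForm k V} {g : V ≃ₗ[k] V} {μ : kˣ}
    (hg : IsProperWith q g μ) : IsProperWith q g⁻¹ μ⁻¹ := by
  refine ⟨hg.1.inv, fun h2 => ?_, fun h2 M hM => ?_⟩
  · have e : (g : V →ₗ[k] V) * ((g⁻¹ : V ≃ₗ[k] V) : V →ₗ[k] V) = 1 := by
      ext x
      exact g.apply_symm_apply x
    have d := congrArg LinearMap.det e
    rw [map_mul, map_one, hg.2.1 h2] at d
    rw [Units.val_inv_eq_inv_val, inv_pow]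
    exact eq_inv_of_mul_eq_one_right d
  · obtain ⟨ρ, hρ, tρ⟩ := hg.2.2 h2 M hM
    have gi : ∀ x, g (g⁻¹ x) = x := fun x => g.apply_symm_apply x
    refine ⟨-(((μ⁻¹ : kˣ) : k) ^ 2 •
      ((g : V →ₗ[k] V) ∘ₗ ρ ∘ₗ ((g⁻¹ : V ≃ₗ[k] V) : V →ₗ[k] V))), ?_, ?_⟩
    · intro x y
      have key : ∀ x y, QuadraticMap.polar q x (g (ρ (g⁻¹ y))) =
          μ * QuadraticMap.polar q (g⁻¹ x) (ρ (g⁻¹ y)) := by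
        intro x y
        rw [← hg.1.polar, gi]
      have h := hρ (g⁻¹ x) (g⁻¹ y)
      rw [gi, gi] at h
      have hμ : (μ : k) ≠ 0 := μ.ne_zero
      simp only [LinearMap.neg_apply, LinearMap.smul_apply,
        LinearMap.comp_apply, LinearEquiv.coe_coe, QuadraticMap.polar_neg_right,
        QuadraticMap.polar_smul_right, smul_eq_mul, key, h, Units.val_inv_eq_inv_val]
      field_simp
      ring
    · rw [map_neg, map_smul, trace_conj_inv, tρ]
      simp

/-- The group `GO(V, q)` of similitudes. -/
def GO (q : QuadraticForm k V) : Subgroup (V ≃ₗ[k] V) where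
  carrier := {g | ∃ μ : kˣ, HasMultiplier q g μ}
  mul_mem' := fun ⟨μ, hμ⟩ ⟨ν, hν⟩ => ⟨μ * ν, hμ.mul hν⟩
  one_mem' := ⟨1, HasMultiplier.one q⟩
  inv_mem' := fun ⟨μ, hμ⟩ => ⟨μ⁻¹, hμ.inv⟩

/-- The group `GO⁺(V, q)` of proper similitudes. -/
def GOplus (q : QuadraticForm k V) : Subgroup (V ≃ₗ[k] V) where
  carrier := {g | ∃ μ : kˣ, IsProperWith q g μ}
  mul_mem' := fun ⟨μ, hμ⟩ ⟨ν, hν⟩ => ⟨μ * ν, hμ.mul hν⟩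
  one_mem' := ⟨1, IsProperWith.one q⟩
  inv_mem' := fun ⟨μ, hμ⟩ => ⟨μ⁻¹, hμ.inv⟩

variable (k V) in
/-- The subgroup `k^* I` of homotheties in `GL(V)`. -/
def homotheties : Subgroup (V ≃ₗ[k] V) :=
  (DistribMulAction.toModuleAut k V : kˣ →* (V ≃ₗ[k] V)).range

instance : (homotheties k V).Normal where
  conj_mem := by
    rintro _ ⟨ρ, rfl⟩ g
    refine ⟨ρ, ?_⟩
    ext x
    change ρ • x = g (ρ • g⁻¹ x)
    rw [Units.smul_def, Units.smul_def, map_smul]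
    congr 1
    exact (g.apply_symm_apply x).symm

variable (k V) in
/-- `PGL(V) = GL(V) / k^* I`. -/
abbrev PGL : Type v := (V ≃ₗ[k] V) ⧸ homotheties k V

/-- The class in `PGL(V)` of an element of `GL(V)`. -/
def pcl (g : V ≃ₗ[k] V) : PGL k V := QuotientGroup.mk g

/-- `PGO⁺(V, q)`, as a subgroup of `PGL(V)`. -/
def PGOplus (q : QuadraticForm k V) : Subgroup (PGL k V) :=
  (GOplus q).map (QuotientGroup.mk' (homotheties k V))

/-- The subsets `PGO^i(V, q)` of `PGL(V)`, `i ∈ {1, -1}`: classes of proper similitudes for `i = 1`,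
and of improper ones for `i = -1`. -/
def PGOsign (q : QuadraticForm k V) (i : ℤˣ) : Set (PGL k V) :=
  if i = 1 then pcl '' (GOplus q : Set (V ≃ₗ[k] V))
  else pcl '' ((GO q : Set (V ≃ₗ[k] V)) \ GOplus q)

end QuadraticSpace

/-! ## Hurwitz algebras (associative case) -/

section Hurwitz

variable {k : Type u} {A : Type v} [Field k] [Ring A] [Algebra k A]

/-- The quadratic form `n` makes the unital algebra `A` a Hurwitz algebra `(A, n)`: the polar form
of `n` is non-degenerate and `n` is multiplicative (and `A` is not zero). -/
class IsHurwitzNorm (n : QuadraticForm k A) : Prop where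
  nontrivial : Nontrivial A
  nondegenerate : ∀ x, (∀ y, QuadraticMap.polar n x y = 0) → x = 0
  map_mul : ∀ x y, n (x * y) = n x * n y

lemma norm_one (n : QuadraticForm k A) [h : IsHurwitzNorm n] : n 1 = 1 := by
  have h1 : n 1 = n 1 * n 1 := by simpa using h.map_mul 1 1
  by_cases h0 : n 1 = 0
  · exfalso
    have hz : ∀ x, n x = 0 := fun x => by simpa [h0] using h.map_mul x 1
    have := h.nontrivial
    exact one_ne_zero (h.nondegenerate (1 : A) (fun y => by simp [QuadraticMap.polar, hz]))
  · exact (mul_left_cancel₀ h0 (by rw [mul_one]; exact h1)).symm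

/-- The canonical involution `κ`, `κ x = ⟨x, 1⟩ 1 - x`, of a Hurwitz algebra. -/
def kappa (n : QuadraticForm k A) [IsHurwitzNorm n] : A ≃ₗ[k] A :=
  LinearEquiv.ofInvolutive
    ({ toFun := fun x => QuadraticMap.polar n x 1 • (1 : A) - x
       map_add' := fun x y => by rw [QuadraticMap.polar_add_left, add_smul]; abel
       map_smul' := fun c x => by
        rw [QuadraticMap.polar_smul_left, RingHom.id_apply, smul_sub, smul_smul, smul_eq_mul] } :
      A →ₗ[k] A)
    (by
      intro x
      have h1 : QuadraticMap.polar n (1 : A) 1 = 2 := by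
        rw [QuadraticMap.polar_self, norm_one, nsmul_eq_mul, mul_one, Nat.cast_ofNat]
      change QuadraticMap.polar n (QuadraticMap.polar n x 1 • (1 : A) - x) 1 • (1 : A) -
        (QuadraticMap.polar n x 1 • (1 : A) - x) = x
      rw [QuadraticMap.polar_sub_left, QuadraticMap.polar_smul_left, h1, sub_smul, smul_eq_mul,
        mul_smul, two_smul, smul_add]
      abel)

variable (k) in
/-- Left multiplication `L_a : x ↦ a x` by an invertible element. -/
def lmul (a : Aˣ) : A ≃ₗ[k] A := Units.mulLeftLinearEquiv k A a

variable (k) in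
/-- Right multiplication `R_a : x ↦ x a` by an invertible element. -/
def rmul (a : Aˣ) : A ≃ₗ[k] A where
  toFun x := x * a
  map_add' x y := add_mul x y a
  map_smul' c x := smul_mul_assoc c x (a : A)
  invFun x := x * (a⁻¹ : Aˣ)
  left_inv x := Units.mul_inv_cancel_right x a
  right_inv x := Units.inv_mul_cancel_right x a

variable (k) in
lemma rmul_mul (v w : Aˣ) : rmul k (v * w) = rmul k w * rmul k v := by
  ext x
  change x * ((v * w : Aˣ) : A) = x * v * w
  rw [Units.val_mul, mul_assoc]

variable (k) in
lemma lmul_mul (v w : Aˣ) : lmul k (v * w) = lmul k v * lmul k w := map_mul _ v w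

variable (k) in
lemma rmul_inv (w : Aˣ) : rmul k w⁻¹ = (rmul k w)⁻¹ := by
  ext x
  rfl

variable (k) in
lemma lmul_inv (w : Aˣ) : lmul k w⁻¹ = (lmul k w)⁻¹ := map_inv _ w

lemma pcl_mul (f g : A ≃ₗ[k] A) : pcl (f * g) = pcl f * pcl g := rfl

lemma pcl_inv (f : A ≃ₗ[k] A) : pcl f⁻¹ = (pcl f)⁻¹ := rfl

variable (k A) in
/-- The orbit relation of the action `w · (α, β) = (R_w⁻¹ α, L_w β)` of `N(A)^*` on `PGL(A)²`.
As `A` is associative, its nucleus `N(A)` is `A`. -/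
def nuclearSetoid : Setoid (PGL k A × PGL k A) where
  r x y := ∃ w : Aˣ, y = ((pcl (rmul k w))⁻¹ * x.1, pcl (lmul k w) * x.2)
  iseqv :=
    { refl := fun x => ⟨1, by
        have h1 : rmul k (1 : Aˣ) = 1 := by ext x; exact mul_one x
        have h2 : lmul k (1 : Aˣ) = 1 := by ext x; exact one_mul x
        rw [h1, h2]
        change x = ((1 : PGL k A)⁻¹ * x.1, (1 : PGL k A) * x.2)
        simp⟩
      symm := by
        rintro x _ ⟨w, rfl⟩
        refine ⟨w⁻¹, ?_⟩
        simp [rmul_inv, lmul_inv, pcl_inv]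
      trans := by
        rintro x _ _ ⟨w, rfl⟩ ⟨v, rfl⟩
        refine ⟨v * w, ?_⟩
        simp [rmul_mul, lmul_mul, pcl_mul, mul_assoc] }

variable (k A) in
/-- The set `X_A = PGL(A)² / N(A)^*`, parametrising the principal isotopes of `A`. -/
def XSet : Type v := Quotient (nuclearSetoid k A)

/-- The class in `X_A` of a pair in `PGL(A)²`. -/
def xcl (α β : PGL k A) : XSet k A := Quotient.mk (nuclearSetoid k A) (α, β)

lemma xcl_nuclear (w : Aˣ) (α β : PGL k A) :
    xcl ((pcl (rmul k w))⁻¹ * α) (pcl (lmul k w) * β) = xcl α β :=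
  (Quotient.sound (⟨w, rfl⟩ : (nuclearSetoid k A).r (α, β) _)).symm

/-- The similitudes `f₁, f₂` are triality components of `f`: `f (x y) = f₁ (x) f₂ (y)`. -/
structure IsTriality (n : QuadraticForm k A) (f f₁ f₂ : A ≃ₗ[k] A) : Prop where
  mem₁ : f₁ ∈ GO n
  mem₂ : f₂ ∈ GO n
  map_mul : ∀ x y, f (x * y) = f₁ x * f₂ y

/-- The relation `φ · x = y` between elements `x`, `y` of `X_A`, for the action
`φ · (α, β) = (φ₁ α φ⁻¹, φ₂ β φ⁻¹)` of `PGO⁺(A)` on `X_A`, where `φ₁, φ₂` are triality components of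
the proper similitude `φ`. -/
def ActsTo (n : QuadraticForm k A) (φ : PGL k A) (x y : XSet k A) : Prop :=
  ∃ f ∈ GOplus n, pcl f = φ ∧ ∃ f₁ f₂ : A ≃ₗ[k] A, IsTriality n f f₁ f₂ ∧
    ∃ α β : PGL k A, x = xcl α β ∧ y = xcl (pcl f₁ * α * φ⁻¹) (pcl f₂ * β * φ⁻¹)

lemma lmul_mem_GO (n : QuadraticForm k A) [h : IsHurwitzNorm n] (w : Aˣ) : lmul k w ∈ GO n := by
  have e : n (w : A) * n ((w⁻¹ : Aˣ) : A) = 1 := by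
    rw [← h.map_mul, Units.mul_inv, norm_one]
  exact ⟨Units.mkOfMulEqOne _ _ e, fun x => h.map_mul w x⟩

lemma rmul_mem_GO (n : QuadraticForm k A) [h : IsHurwitzNorm n] (w : Aˣ) : rmul k w ∈ GO n := by
  have e : n (w : A) * n ((w⁻¹ : Aˣ) : A) = 1 := by
    rw [← h.map_mul, Units.mul_inv, norm_one]
  exact ⟨Units.mkOfMulEqOne _ _ e, fun x => (h.map_mul x w).trans (mul_comm _ _)⟩

lemma ActsTo.one (n : QuadraticForm k A) (x : XSet k A) : ActsTo n 1 x x := by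
  obtain ⟨⟨α, β⟩, rfl⟩ := Quotient.exists_rep x
  refine ⟨1, one_mem _, rfl, 1, 1, ⟨one_mem _, one_mem _, fun _ _ => rfl⟩, α, β, rfl, ?_⟩
  change xcl α β = xcl (1 * α * 1⁻¹) (1 * β * 1⁻¹)
  simp

lemma ActsTo.mul {n : QuadraticForm k A} [IsHurwitzNorm n] {φ ψ : PGL k A} {x y z : XSet k A}
    (h : ActsTo n φ x y) (h' : ActsTo n ψ y z) : ActsTo n (ψ * φ) x z := by
  obtain ⟨f, hf, rfl, f₁, f₂, hF, α, β, rfl, rfl⟩ := h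
  obtain ⟨g, hg, rfl, g₁, g₂, hG, γ, δ, hy, rfl⟩ := h'
  obtain ⟨w, hw⟩ := Quotient.exact hy
  obtain ⟨rfl, rfl⟩ := Prod.mk.inj hw
  refine ⟨g * f, mul_mem hg hf, rfl, g₁ * (rmul k w)⁻¹ * f₁, g₂ * lmul k w * f₂,
    ⟨mul_mem (mul_mem hG.mem₁ (inv_mem (rmul_mem_GO n w))) hF.mem₁,
      mul_mem (mul_mem hG.mem₂ (lmul_mem_GO n w)) hF.mem₂, fun x y => ?_⟩, α, β, rfl, ?_⟩
  · change g (f (x * y)) = g₁ (f₁ x * (w⁻¹ : Aˣ)) * g₂ (w * f₂ y)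
    rw [hF.map_mul, ← hG.map_mul, ← mul_assoc, Units.inv_mul_cancel_right]
  · simp [pcl_mul, pcl_inv, mul_assoc]

lemma ActsTo.inv {n : QuadraticForm k A} {φ : PGL k A} {x y : XSet k A}
    (h : ActsTo n φ x y) : ActsTo n φ⁻¹ y x := by
  obtain ⟨f, hf, rfl, f₁, f₂, hF, α, β, rfl, rfl⟩ := h
  refine ⟨f⁻¹, inv_mem hf, rfl, f₁⁻¹, f₂⁻¹, ⟨inv_mem hF.mem₁, inv_mem hF.mem₂, fun x y => ?_⟩,
    _, _, rfl, ?_⟩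
  · apply f.injective
    have e : ∀ (e : A ≃ₗ[k] A) z, e (e⁻¹ z) = z := fun e z => e.apply_symm_apply z
    rw [e, hF.map_mul, e, e]
  · simp [pcl_inv, mul_assoc]

/-- The groupoid `𝒳(A)` of the action of `PGO⁺(A)` on `X_A`. Its objects are the elements of
`X_A`. -/
structure XGroupoid (n : QuadraticForm k A) : Type v where
  pt : XSet k A

/-- A morphism `x ⟶ y` of `𝒳(A)` is an element `φ` of `PGO⁺(A)` with `φ · x = y`. -/
instance (n : QuadraticForm k A) [IsHurwitzNorm n] : Groupoid (XGroupoid n) where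
  Hom x y := {φ : PGOplus n // ActsTo n (φ : PGL k A) x.pt y.pt}
  id x := ⟨1, ActsTo.one n x.pt⟩
  comp f g := ⟨g.1 * f.1, f.2.mul g.2⟩
  id_comp f := Subtype.ext (mul_one f.1)
  comp_id f := Subtype.ext (one_mul f.1)
  assoc f g h := Subtype.ext (mul_assoc h.1 g.1 f.1).symm
  inv f := ⟨f.1⁻¹, f.2.inv⟩
  inv_comp f := Subtype.ext (mul_inv_cancel f.1)
  comp_inv f := Subtype.ext (inv_mul_cancel f.1)

/-- The element of `PGL(A)` underlying a morphism of `𝒳(A)`. -/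
def homElt {n : QuadraticForm k A} [IsHurwitzNorm n] {x y : XGroupoid n} (f : x ⟶ y) : PGL k A :=
  (f.1 : PGL k A)

/-- The objects of `𝒳^{c(i,j)}(A)`: the subset `(PGO^i(A) × PGO^j(A)) / N(A)^*` of `X_A`. -/
def signPart (n : QuadraticForm k A) [IsHurwitzNorm n] (i j : ℤˣ) : ObjectProperty (XGroupoid n) :=
  fun x => ∃ α ∈ PGOsign n i, ∃ β ∈ PGOsign n j, x.pt = xcl α β

/-- The full subcategory `𝒳^{c(i,j)}(A)` of `𝒳(A)`. -/
abbrev XSign (n : QuadraticForm k A) [IsHurwitzNorm n] (i j : ℤˣ) : Type v :=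
  (signPart n i j).FullSubcategory

variable (k A) in
/-- The subgroup `k^*` of `A^*`. -/
def scalarUnits : Subgroup Aˣ := (Units.map (algebraMap k A : k →* A)).range

instance : (scalarUnits k A).Normal where
  conj_mem := by
    rintro _ ⟨ρ, rfl⟩ g
    refine ⟨ρ, ?_⟩
    rw [eq_mul_inv_iff_mul_eq]
    ext
    exact Algebra.commutes (ρ : k) (g : A)

variable (k A) in
/-- The group `A^* / k^*`. -/
abbrev PUnits : Type v := Aˣ ⧸ scalarUnits k A

variable (k) in
/-- The class in `A^* / k^*` of an element of `A^*`. -/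
def ucl (a : Aˣ) : PUnits k A := QuotientGroup.mk a

variable (k A) in
/-- The groupoid `𝒵^c(A)` of the action `s · (a, b) = (s a s⁻¹, s b s⁻¹)` of `A^* / k^*` on
`(A^* / k^*)²`.  (`ConjAct G` is the group `G`, acting on `G` by conjugation.) -/
abbrev ZGroupoid : Type v := ActionCategory (ConjAct (PUnits k A)) (PUnits k A × PUnits k A)

variable (k) in
/-- The object `(a, b)` of `𝒵^c(A)`. -/
def zobj (a b : Aˣ) : ZGroupoid k A :=
  ActionCategory.objEquiv (ConjAct (PUnits k A)) (PUnits k A × PUnits k A) (ucl k a, ucl k b)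

/-- The element of `A^* / k^*` underlying a morphism of `𝒵^c(A)`. -/
def zhomElt {x y : ZGroupoid k A} (f : x ⟶ y) : PUnits k A :=
  ConjAct.ofConjAct f.val

/-- The normal forms: `(L_a, R_b)` for the signs `(1, 1)`, `(R_a κ, R_b)` for `(-1, 1)`,
`(L_a, L_b κ)` for `(1, -1)` and `(L_a κ, R_b κ)` for `(-1, -1)`. -/
def normalForm (n : QuadraticForm k A) [IsHurwitzNorm n] (i j : ℤˣ) (a b : Aˣ) : XSet k A :=
  if i = 1 then
    if j = 1 then xcl (pcl (lmul k a)) (pcl (rmul k b))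
    else xcl (pcl (lmul k a)) (pcl (lmul k b * kappa n))
  else
    if j = 1 then xcl (pcl (rmul k a * kappa n)) (pcl (rmul k b))
    else xcl (pcl (lmul k a * kappa n)) (pcl (rmul k b * kappa n))

variable (k) in
/-- The inner automorphism `c_s = L_s R_s⁻¹`, `x ↦ s x s⁻¹`. -/
def innerAut (s : Aˣ) : A ≃ₗ[k] A := lmul k s * (rmul k s)⁻¹

end Hurwitz

end QuatComp

end

/-! The proof turns the problem into bookkeeping in the group (A^*/k^*)². Let (p, q) stand for the
class of x ↦ p x q⁻¹; this gives a homomorphism `biHom` into PGL(A), injective because A is central.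
Every similitude is x ↦ a x b or x ↦ a κ(x) b (`mem_translationKappaGroup_of_mem_GO`), and the first
kind are exactly the proper ones. So PGO⁺(A) is the image of `biHom`, PGO⁻¹(A) is that image times
κ, and commuting κ past (p, q) swaps p and q.

The triality components of (p, q) are (p, r) and (r, q), where r is arbitrary: changing r is the
action of A^* divided out in X_A. Hence (p, q) sends (α, β) to ((p, r) α (p, q)⁻¹, (r, q) β (p,
q)⁻¹) (`actsTo_xcl_iff`). In a normal form one coordinate of α and one of β is trivial. Preserving
both forces p = q = r, and the other two coordinates are then conjugated by the common value: the
functor is full, and faithful by injectivity of `biHom`. Conversely p, q, r can be chosen to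
trivialise these two coordinates of any object, which gives essential surjectivity.

The classification of similitudes is a Cartan–Dieudonné argument valid in every characteristic. The
reflection in v is x ↦ -n(v)⁻¹ v κ(x) v, and an isometry fixing 1 is corrected by reflections, and
if necessary by κ, until it fixes a basis 1, u, j, uj. Properness of L_a and R_a and improperness of
κ are computed by determinants or by the Dickson invariant. -/

namespace QuatComp

open QuadraticMap (polar)

/-! ### Adjoints for the polar form, determinants and the Dickson invariant. -/

section Adjoint

variable {k V : Type*} [Field k] [AddCommGroup V] [Module k V] [FiniteDimensional k V]
  {q : QuadraticForm k V}

/-- The polar form of a non-degenerate quadratic form identifies `V` with its dual. -/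
noncomputable def polarDual (hq : ∀ x, (∀ y, polar q x y = 0) → x = 0) :
    V ≃ₗ[k] Module.Dual k V :=
  LinearMap.linearEquivOfInjective (V₂ := Module.Dual k V) q.polarBilin
    (LinearMap.ker_eq_bot.mp (LinearMap.ker_eq_bot'.mpr fun x hx =>
      hq x fun y => LinearMap.congr_fun hx y))
    Subspace.dual_finrank_eq.symm

lemma polarDual_apply (hq : ∀ x, (∀ y, polar q x y = 0) → x = 0) (x y : V) :
    polarDual hq x y = polar q x y := rfl

/-- Every bilinear form is represented by an endomorphism via the polar form. -/
lemma exists_representing (hq : ∀ x, (∀ y, polar q x y = 0) → x = 0)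
    (P : V →ₗ[k] V →ₗ[k] k) : ∃ τ : V →ₗ[k] V, ∀ x y, P x y = polar q x (τ y) := by
  refine ⟨((polarDual hq).symm : Module.Dual k V →ₗ[k] V) ∘ₗ P.flip, fun x y => ?_⟩
  rw [QuadraticMap.polar_comm, ← polarDual_apply hq]
  simp

/-- Transport along V ≅ V* turns adjoints into transposes, so adjoint maps share trace and
characteristic polynomial. -/
lemma eq_conj_dualMap (hq : ∀ x, (∀ y, polar q x y = 0) → x = 0) {f g : V →ₗ[k] V}
    (h : ∀ x y, polar q (f x) y = polar q x (g y)) :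
    (polarDual hq).conj f = g.dualMap := by
  apply LinearMap.ext
  intro φ
  obtain ⟨x, rfl⟩ := (polarDual hq).surjective φ
  ext y
  simp [LinearEquiv.conj_apply, polarDual_apply, h]

lemma trace_eq_of_adjoint (hq : ∀ x, (∀ y, polar q x y = 0) → x = 0) {f g : V →ₗ[k] V}
    (h : ∀ x y, polar q (f x) y = polar q x (g y)) :
    LinearMap.trace k V f = LinearMap.trace k V g := by
  rw [← LinearMap.trace_conj' f (polarDual hq), eq_conj_dualMap hq h]
  exact LinearMap.trace_transpose' g

lemma charpoly_eq_of_adjoint (hq : ∀ x, (∀ y, polar q x y = 0) → x = 0) {f g : V →ₗ[k] V}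
    (h : ∀ x y, polar q (f x) y = polar q x (g y)) : f.charpoly = g.charpoly := by
  rw [← LinearEquiv.charpoly_conj (polarDual hq) f, eq_conj_dualMap hq h]
  have b := Module.finBasis k V
  rw [← LinearMap.charpoly_toMatrix g b, ← LinearMap.charpoly_toMatrix _ b.dualBasis,
    ← Matrix.charpoly_transpose, LinearMap.dualMap_def, LinearMap.toMatrix_transpose,
    Matrix.transpose_transpose]

-- Since f + g and f g are scalar, (X - f)(X - g) is the scalar matrix X² - tX + c; take
-- determinants.
open Polynomial in
lemma charpoly_mul_of_add_of_mul {f g : V →ₗ[k] V} {t c : k} (hadd : f + g = t • 1)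
    (hmul : f * g = c • 1) :
    f.charpoly * g.charpoly = (X ^ 2 - C t * X + C c) ^ Module.finrank k V := by
  have b := Module.finBasis k V
  rw [← LinearMap.charpoly_toMatrix f b, ← LinearMap.charpoly_toMatrix g b]
  have hadd' := congrArg (LinearMap.toMatrix b b) hadd
  have hmul' := congrArg (LinearMap.toMatrix b b) hmul
  rw [map_add, map_smul, LinearMap.toMatrix_one] at hadd'
  rw [LinearMap.toMatrix_mul, map_smul, LinearMap.toMatrix_one] at hmul'
  set F := LinearMap.toMatrix b b f
  set G := LinearMap.toMatrix b b g
  have key : F.charmatrix * G.charmatrix =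
      Matrix.scalar _ (X ^ 2 - C t * X + C c : k[X]) := by
    have ha := congrArg (C : k →+* k[X]).mapMatrix hadd'
    have hm := congrArg (C : k →+* k[X]).mapMatrix hmul'
    have hs : ∀ r : k, (C : k →+* k[X]).mapMatrix (r • (1 : Matrix (Fin (Module.finrank k V)) _ k))
        = Matrix.scalar _ (C r) := by
      intro r
      ext i j : 1
      by_cases hij : i = j <;> simp [hij]
    rw [map_add, hs] at ha
    rw [map_mul, hs] at hm
    have hc : (C : k →+* k[X]).mapMatrix F * Matrix.scalar _ (X : k[X]) =
        Matrix.scalar _ X * (C : k →+* k[X]).mapMatrix F :=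
      (Matrix.scalar_commute X (fun r => Commute.all _ _) _).symm.eq
    rw [Matrix.charmatrix, Matrix.charmatrix, sub_mul, mul_sub, mul_sub, hm, hc, map_add, map_sub,
      map_pow, mul_comm (C t) X, map_mul, ← ha, sq, mul_add]
    abel
  rw [Matrix.charpoly, Matrix.charpoly, ← Matrix.det_mul, key]
  simp

open Polynomial in
/-- An endomorphism `f` whose adjoint is `t - f`, with `f (t - f) = c`, has determinant
`c ^ (dim V / 2)`. -/
lemma det_eq_pow_of_adjoint (hq : ∀ x, (∀ y, polar q x y = 0) → x = 0) {f g : V →ₗ[k] V}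
    (h : ∀ x y, polar q (f x) y = polar q x (g y)) {t c : k} (hadd : f + g = t • 1)
    (hmul : f * g = c • 1) {m : ℕ} (hm : Module.finrank k V = 2 * m) :
    LinearMap.det f = c ^ m := by
  have h1 := charpoly_mul_of_add_of_mul hadd hmul
  rw [← charpoly_eq_of_adjoint hq h, hm, pow_mul', ← sq] at h1
  have hr : (X ^ 2 - C t * X + C c : k[X]).Monic := by monicity!
  have h2 : f.charpoly = (X ^ 2 - C t * X + C c) ^ m := by
    -- The squares agree, so the polynomials agree up to sign; both being monic, the minus sign can
    -- occur only when 1 = -1.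
    rcases sq_eq_sq_iff_eq_or_eq_neg.mp h1 with h2 | h2
    · exact h2
    · have hl := congrArg leadingCoeff h2
      rw [f.charpoly_monic.leadingCoeff, leadingCoeff_neg, (hr.pow m).leadingCoeff] at hl
      have hl' : (1 : k[X]) = -1 := by simpa using congrArg C hl
      rw [h2, neg_eq_neg_one_mul, ← hl', one_mul]
  rw [LinearMap.det_eq_sign_charpoly_coeff, h2, hm, pow_mul]
  simp [coeff_zero_eq_eval_zero]

/-- An alternating form is the antisymmetrisation of some bilinear form. -/
lemma exists_sub_flip_eq {N : V →ₗ[k] V →ₗ[k] k} (hN : ∀ x, N x x = 0) :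
    ∃ P : V →ₗ[k] V →ₗ[k] k, ∀ x y, N x y = P x y - P y x := by
  have b := Module.finBasis k V
  have hanti : ∀ x y, N y x = -N x y := by
    intro x y
    have := hN (x + y)
    simp only [map_add, LinearMap.add_apply, hN] at this
    linear_combination this
  -- The strictly upper triangular half of the Gram matrix: no division by 2 is needed.
  let P : V →ₗ[k] V →ₗ[k] k :=
    Matrix.toLinearMap₂ b b (Matrix.of fun i j => if i < j then N (b i) (b j) else 0)
  have : N = P - P.flip := by
    refine LinearMap.ext_basis b b fun i j => ?_
    simp only [LinearMap.sub_apply, LinearMap.flip_apply, P, Matrix.toLinearMap₂_apply_basis,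
      Matrix.of_apply]
    rcases lt_trichotomy i j with hij | rfl | hij
    · simp [hij, hij.not_gt]
    · simp [hN]
    · simp [hij, hij.not_gt, hanti (b j) (b i)]
  exact ⟨P, fun x y => LinearMap.congr_fun₂ this x y⟩

/-- The Dickson invariant can be computed from any one bilinear form `M₀` with diagonal `q`. -/
lemma DicksonVanishes.of_exists (hq : ∀ x, (∀ y, polar q x y = 0) → x = 0) {g : V ≃ₗ[k] V}
    {μ : kˣ} (hg : HasMultiplier q g μ) {M₀ : V →ₗ[k] V →ₗ[k] k} (hM₀ : ∀ x, M₀ x x = q x)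
    {ρ₀ : V →ₗ[k] V}
    (hρ₀ : ∀ x y, M₀ (g x) (g y) = μ * M₀ x y + (polar q x (ρ₀ y) - polar q y (ρ₀ x)))
    (hρ₀_trace : LinearMap.trace k V ρ₀ = 0) : DicksonVanishes q g μ := by
  intro M hM
  obtain ⟨P, hP⟩ := exists_sub_flip_eq (N := M - M₀) (fun x => by simp [hM, hM₀])
  obtain ⟨τ, hτ⟩ := exists_representing hq P
  have hMM : ∀ x y, M x y = M₀ x y + (polar q x (τ y) - polar q y (τ x)) := by
    intro x y
    have := hP x y
    rw [hτ, hτ, LinearMap.sub_apply, LinearMap.sub_apply] at this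
    linear_combination this
  have key : ∀ x y, polar q (g x) (τ (g y)) = μ * polar q x (g⁻¹ (τ (g y))) := by
    intro x y
    rw [← hg.polar, ← LinearEquiv.mul_apply g g⁻¹, mul_inv_cancel]
    rfl
  -- Replacing M₀ by M changes ρ by μ (g⁻¹ τ g - τ), which has trace zero.
  refine ⟨ρ₀ + (μ : k) • ((((g⁻¹ : V ≃ₗ[k] V) : V →ₗ[k] V) ∘ₗ τ ∘ₗ (g : V →ₗ[k] V)) - τ), ?_, ?_⟩
  · intro x y
    simp only [hMM, hρ₀, key, LinearMap.add_apply, LinearMap.smul_apply, LinearMap.sub_apply,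
      LinearMap.comp_apply, LinearEquiv.coe_coe, QuadraticMap.polar_add_right,
      QuadraticMap.polar_smul_right, QuadraticMap.polar_sub_right, smul_eq_mul]
    ring
  · have := trace_conj_inv g⁻¹ τ
    rw [inv_inv] at this
    rw [map_add, map_smul, map_sub, this, hρ₀_trace]
    simp

/-- In characteristic two, a self-adjoint endomorphism for the polar form has trace zero. -/
lemma trace_eq_zero_of_selfAdjoint (hq : ∀ x, (∀ y, polar q x y = 0) → x = 0)
    (h2 : (2 : k) = 0) {σ : V →ₗ[k] V} (h : ∀ x y, polar q x (σ y) = polar q y (σ x)) :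
    LinearMap.trace k V σ = 0 := by
  obtain ⟨M, hM⟩ := LinearMap.BilinMap.toQuadraticMap_surjective q
  obtain ⟨m, hm⟩ := exists_representing hq M
  -- As the polar form is M plus its flip, m and 1 - m are adjoint. Then σ (1 - m) and m σ are
  -- adjoint, and comparing traces gives tr σ = 2 tr(σ m) = 0.
  have hadj : ∀ x y, polar q ((1 - m : V →ₗ[k] V) x) y = polar q x (m y) := by
    intro x y
    have h1 : polar q x y = M x y + M y x := by
      rw [← hM, LinearMap.BilinMap.polar_toQuadraticMap]
    rw [LinearMap.sub_apply, QuadraticMap.polar_sub_left, Module.End.one_apply, h1, hm, hm,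
      QuadraticMap.polar_comm q (m x) y]
    ring
  have h1 : LinearMap.trace k V (σ * (1 - m)) = LinearMap.trace k V (m * σ) := by
    refine trace_eq_of_adjoint hq fun x y => ?_
    rw [Module.End.mul_apply, Module.End.mul_apply, ← hadj, QuadraticMap.polar_comm, h]
  rw [mul_sub, mul_one, map_sub, LinearMap.trace_mul_comm k m σ] at h1
  linear_combination h1 + LinearMap.trace k V (σ * m) * h2

end Adjoint

/-! ### Identities between norm, involution and product. -/

section Identities

variable {k A : Type*} [Field k] [Ring A] [Algebra k A] (n : QuadraticForm k A) [IsHurwitzNorm n]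

lemma kappa_apply (x : A) : kappa n x = polar n x 1 • (1 : A) - x := rfl

lemma kappa_kappa (x : A) : kappa n (kappa n x) = x := (kappa n).left_inv x

lemma add_kappa (x : A) : x + kappa n x = polar n x 1 • (1 : A) := by
  rw [kappa_apply]; abel

lemma eq_of_polar_eq {x y : A} (h : ∀ z, polar n x z = polar n y z) : x = y :=
  sub_eq_zero.mp (IsHurwitzNorm.nondegenerate (n := n) _ fun z => by
    rw [QuadraticMap.polar_sub_left, h, sub_self])

omit [IsHurwitzNorm n] in
lemma polar_self_eq (x : A) : polar n x x = 2 * n x := by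
  rw [QuadraticMap.polar_self, nsmul_eq_mul, Nat.cast_ofNat]

lemma polar_mul_mul_left (x y z : A) : polar n (x * y) (x * z) = n x * polar n y z := by
  simp only [polar, ← mul_add, IsHurwitzNorm.map_mul (n := n)]
  ring

lemma polar_mul_mul_right (x y z : A) : polar n (x * z) (y * z) = polar n x y * n z := by
  simp only [polar, ← add_mul, IsHurwitzNorm.map_mul (n := n)]
  ring

/-- Linearises ⟨xy, xz⟩ = n(x)⟨y, z⟩ in x; setting a variable to 1 yields the adjoints of left and
right multiplications. -/
lemma polar_mul_add_polar_mul (x y z w : A) :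
    polar n (x * y) (w * z) + polar n (w * y) (x * z) = polar n x w * polar n y z := by
  have h := polar_mul_mul_left n (x + w) y z
  rw [add_mul, add_mul, QuadraticMap.polar_add_left, QuadraticMap.polar_add_right,
    QuadraticMap.polar_add_right, polar_mul_mul_left, polar_mul_mul_left] at h
  have : polar n x w = n (x + w) - n x - n w := rfl
  rw [this]
  linear_combination h

/-- The adjoint of left multiplication by `x` is left multiplication by `κ x`. -/
lemma polar_mul_left (x y z : A) : polar n (x * y) z = polar n y (kappa n x * z) := by
  have h := polar_mul_add_polar_mul n x y z 1
  rw [one_mul, one_mul] at h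
  rw [kappa_apply, sub_mul, smul_mul_assoc, one_mul, QuadraticMap.polar_sub_right,
    QuadraticMap.polar_smul_right, smul_eq_mul]
  linear_combination h

/-- The adjoint of right multiplication by `y` is right multiplication by `κ y`. -/
lemma polar_mul_right (x y z : A) : polar n (x * y) z = polar n x (z * kappa n y) := by
  have h := polar_mul_add_polar_mul n x y 1 z
  rw [mul_one, mul_one] at h
  rw [kappa_apply, mul_sub, mul_smul_comm, mul_one, QuadraticMap.polar_sub_right,
    QuadraticMap.polar_smul_right, smul_eq_mul]
  rw [QuadraticMap.polar_comm n x (z * y)]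
  linear_combination h

lemma kappa_mul_self (x : A) : kappa n x * x = algebraMap k A (n x) := by
  refine eq_of_polar_eq n fun z => ?_
  rw [polar_mul_left, kappa_kappa, Algebra.algebraMap_eq_smul_one, QuadraticMap.polar_smul_left,
    smul_eq_mul, ← polar_mul_mul_left, mul_one]

lemma mul_kappa_self (x : A) : x * kappa n x = algebraMap k A (n x) := by
  rw [← kappa_mul_self, kappa_apply, mul_sub, sub_mul, mul_smul_comm, smul_mul_assoc, mul_one,
    one_mul]

lemma polar_kappa_left (x y : A) : polar n (kappa n x) y = polar n 1 (x * y) := by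
  rw [← kappa_kappa n x, ← polar_mul_left, mul_one, kappa_kappa]

lemma kappa_mul (x y : A) : kappa n (x * y) = kappa n y * kappa n x := by
  refine eq_of_polar_eq n fun z => ?_
  rw [polar_kappa_left, mul_assoc, ← polar_kappa_left, polar_mul_left, kappa_kappa]

lemma map_kappa (x : A) : n (kappa n x) = n x := by
  have h : algebraMap k A (n (kappa n x)) = algebraMap k A (n x) := by
    rw [← kappa_mul_self, kappa_kappa, mul_kappa_self]
  have := IsHurwitzNorm.nontrivial (n := n)
  exact (algebraMap k A).injective h

lemma kappa_one : kappa n (1 : A) = 1 := by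
  rw [kappa_apply, polar_self_eq, norm_one, mul_one, two_smul]; abel

lemma kappa_mem_GO : kappa n ∈ GO n := ⟨1, fun x => by simp [map_kappa]⟩

lemma norm_ne_zero (a : Aˣ) : n (a : A) ≠ 0 := by
  intro h
  have e : n (a : A) * n ((a⁻¹ : Aˣ) : A) = 1 := by
    rw [← IsHurwitzNorm.map_mul (n := n), Units.mul_inv, norm_one]
  simp [h] at e

/-- The norm of a unit as a unit of the base field. -/
noncomputable def unitNorm (a : Aˣ) : kˣ := Units.mk0 (n a) (norm_ne_zero n a)

variable {n} in
lemma isUnit_of_norm_ne_zero {x : A} (h : n x ≠ 0) : IsUnit x := by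
  have hu : IsUnit (algebraMap k A (n x)) := (IsUnit.mk0 _ h).map _
  have h1 : IsUnit (x * kappa n x) := by rwa [mul_kappa_self]
  have h2 : Commute x (kappa n x) := by
    rw [Commute, SemiconjBy, mul_kappa_self, kappa_mul_self]
  exact (h2.isUnit_mul_iff.mp h1).1

lemma lmul_hasMultiplier (a : Aˣ) : HasMultiplier n (lmul k a) (unitNorm n a) := fun x =>
  IsHurwitzNorm.map_mul (n := n) (a : A) x

lemma rmul_hasMultiplier (a : Aˣ) : HasMultiplier n (rmul k a) (unitNorm n a) := fun x =>
  (IsHurwitzNorm.map_mul (n := n) x (a : A)).trans (mul_comm _ _)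

/-- The unit `κ a`. -/
noncomputable def kappaUnit (a : Aˣ) : Aˣ :=
  ⟨kappa n a, kappa n (a⁻¹ : Aˣ), by rw [← kappa_mul, Units.inv_mul, kappa_one],
    by rw [← kappa_mul, Units.mul_inv, kappa_one]⟩

end Identities

/-! ### Multiplications are proper, κ is improper. -/

section Proper

/-- Serves to build bilinear forms ℓ(κ(x) y) and ℓ(x κ(y)) with diagonal n. -/
lemma exists_functional (k A : Type*) [Field k] [Ring A] [Algebra k A] [Nontrivial A] : ∃ ℓ : A →ₗ[k] k, ℓ 1 = 1 := by
  obtain ⟨ℓ, hℓ⟩ := LinearMap.exists_leftInverse_of_injective (Algebra.linearMap k A)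
    (LinearMap.ker_eq_bot.mpr (algebraMap k A).injective)
  exact ⟨ℓ, by simpa using LinearMap.congr_fun hℓ 1⟩

variable {k A : Type*} [Field k] [Ring A] [Algebra k A] (n : QuadraticForm k A) [IsHurwitzNorm n]
  [FiniteDimensional k A]

/-- The adjoint of L_a is L_{κ(a)}, with scalar sum ⟨a, 1⟩ and product n(a); this gives the
determinant. In characteristic two, L_a multiplies ℓ(κ(x) y) by n(a) exactly, so ρ = 0 computes the
Dickson invariant. -/
lemma lmul_mem_GOplus (hdim : Module.finrank k A = 4) (a : Aˣ) : lmul k a ∈ GOplus n := by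
  have := IsHurwitzNorm.nontrivial (n := n)
  refine ⟨unitNorm n a, lmul_hasMultiplier n a, fun _ => ?_, fun _ => ?_⟩
  · rw [hdim]
    refine det_eq_pow_of_adjoint (g := LinearMap.mulLeft k (kappa n a)) (t := polar n (a : A) 1)
      IsHurwitzNorm.nondegenerate (fun x y => polar_mul_left n a x y) ?_ ?_ hdim
    · ext x
      change a * x + kappa n a * x = polar n (a : A) 1 • x
      rw [← add_mul, add_kappa, smul_mul_assoc, one_mul]
    · ext x
      change a * (kappa n a * x) = n (a : A) • x
      rw [← mul_assoc, mul_kappa_self, Algebra.smul_def]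
  · obtain ⟨ℓ, hℓ⟩ := exists_functional k A
    refine DicksonVanishes.of_exists IsHurwitzNorm.nondegenerate (lmul_hasMultiplier n a)
      (M₀ := ((LinearMap.mul k A).compr₂ ℓ) ∘ₗ (kappa n : A →ₗ[k] A)) (ρ₀ := 0) ?_ ?_ (map_zero _)
    · intro x
      change ℓ (kappa n x * x) = n x
      rw [kappa_mul_self, Algebra.algebraMap_eq_smul_one, map_smul, hℓ, smul_eq_mul, mul_one]
    · intro x y
      change ℓ (kappa n (a * x) * (a * y)) = n (a : A) * ℓ (kappa n x * y) + _
      rw [kappa_mul, mul_assoc, ← mul_assoc _ (a : A), kappa_mul_self, ← Algebra.smul_def,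
        mul_smul_comm, map_smul]
      simp [QuadraticMap.polar_zero_right]

lemma rmul_mem_GOplus (hdim : Module.finrank k A = 4) (a : Aˣ) : rmul k a ∈ GOplus n := by
  have := IsHurwitzNorm.nontrivial (n := n)
  refine ⟨unitNorm n a, rmul_hasMultiplier n a, fun _ => ?_, fun _ => ?_⟩
  · rw [hdim]
    refine det_eq_pow_of_adjoint (g := LinearMap.mulRight k (kappa n a)) (t := polar n (a : A) 1)
      IsHurwitzNorm.nondegenerate (fun x y => polar_mul_right n x a y) ?_ ?_ hdim
    · ext x
      change x * a + x * kappa n a = polar n (a : A) 1 • x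
      rw [← mul_add, add_kappa, mul_smul_comm, mul_one]
    · ext x
      change x * kappa n a * a = n (a : A) • x
      rw [mul_assoc, kappa_mul_self, Algebra.smul_def, Algebra.commutes]
  · obtain ⟨ℓ, hℓ⟩ := exists_functional k A
    refine DicksonVanishes.of_exists IsHurwitzNorm.nondegenerate (rmul_hasMultiplier n a)
      (M₀ := ((LinearMap.mul k A).compr₂ ℓ).compl₂ (kappa n : A →ₗ[k] A)) (ρ₀ := 0) ?_ ?_
      (map_zero _)
    · intro x
      change ℓ (x * kappa n x) = n x
      rw [mul_kappa_self, Algebra.algebraMap_eq_smul_one, map_smul, hℓ, smul_eq_mul, mul_one]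
    · intro x y
      change ℓ (x * a * kappa n (y * a)) = n (a : A) * ℓ (x * kappa n y) + _
      rw [kappa_mul, mul_assoc, ← mul_assoc (a : A), mul_kappa_self, ← Algebra.smul_def,
        mul_smul_comm, map_smul]
      simp [QuadraticMap.polar_zero_right]

/-- Up to the factor -1, whose fourth power is 1, κ is x ↦ x - ⟨x, 1⟩1, of determinant 1 - ⟨1, 1⟩ =
-1. -/
lemma det_kappa (hdim : Module.finrank k A = 4) :
    LinearMap.det (kappa n : A →ₗ[k] A) = -1 := by
  have h : (kappa n : A →ₗ[k] A) =
      (-1 : k) • LinearMap.transvection (-(n.polarBilin.flip 1)) (1 : A) := by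
    ext x
    simp [LinearMap.transvection, kappa_apply]
    abel
  rw [h, LinearMap.det_smul, hdim, LinearMap.transvection.det]
  simp [norm_one]
  norm_num

/-- For κ the map x ↦ M(x, 1)1 is a possible ρ, of trace M(1, 1) = 1. Any other ρ differs from it by
a self-adjoint map, which has trace zero. -/
lemma not_dicksonVanishes_kappa (h2 : (2 : k) = 0) : ¬ DicksonVanishes n (kappa n) 1 := by
  intro hD
  obtain ⟨M, hM⟩ := LinearMap.BilinMap.toQuadraticMap_surjective n
  have hdiag : ∀ x, M x x = n x := fun x => by rw [← hM]; rfl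
  have hpolar : ∀ x y, polar n x y = M x y + M y x := fun x y => by
    rw [← hM, LinearMap.BilinMap.polar_toQuadraticMap]
  obtain ⟨ρ, hρ, tρ⟩ := hD M hdiag
  have h := trace_eq_zero_of_selfAdjoint (σ := ρ - (M.flip 1).smulRight (1 : A))
    (IsHurwitzNorm.nondegenerate (n := n)) h2 (fun x y => by
      have h1 := hρ x y
      have e := hpolar y 1
      simp only [kappa_apply, map_sub, map_smul, LinearMap.sub_apply, LinearMap.smul_apply,
        smul_eq_mul, hdiag, norm_one, Units.val_one, one_mul, mul_one] at h1
      simp only [LinearMap.sub_apply, LinearMap.smulRight_apply, LinearMap.flip_apply,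
        QuadraticMap.polar_sub_right, QuadraticMap.polar_smul_right, smul_eq_mul]
      linear_combination -h1 + polar n x 1 * e)
  rw [map_sub, tρ, LinearMap.trace_smulRight, LinearMap.flip_apply, hdiag, norm_one] at h
  simp at h

lemma kappa_notMem_GOplus (hdim : Module.finrank k A = 4) : kappa n ∉ GOplus n := by
  rintro ⟨μ, hμ, hdet, hD⟩
  obtain rfl : μ = 1 := by
    have h := hμ 1
    rw [kappa_one, norm_one, mul_one] at h
    exact Units.ext h.symm
  by_cases h2 : (2 : k) = 0
  · exact not_dicksonVanishes_kappa n h2 (hD h2)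
  · have h := hdet h2
    rw [det_kappa n hdim, Units.val_one, one_pow] at h
    exact h2 (by linear_combination -h)

end Proper

/-! ### The group generated by multiplications and κ, and its reflections. -/

section Similitudes

variable {k A : Type*} [Field k] [Ring A] [Algebra k A] (n : QuadraticForm k A) [IsHurwitzNorm n]

lemma lmul_rmul_comm (a b : Aˣ) : lmul k a * rmul k b = rmul k b * lmul k a := by
  ext x
  exact (mul_assoc (a : A) x b).symm

lemma kappa_mul_lmul (a : Aˣ) : kappa n * lmul k a = rmul k (kappaUnit n a) * kappa n := by
  ext x
  exact kappa_mul n a x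

lemma kappa_mul_rmul (a : Aˣ) : kappa n * rmul k a = lmul k (kappaUnit n a) * kappa n := by
  ext x
  exact kappa_mul n x a

lemma kappa_mul_kappa : kappa n * kappa n = 1 := by
  ext x
  exact kappa_kappa n x

/-- The group of the maps `x ↦ a x b` and `x ↦ a κ(x) b`. -/
def translationKappaGroup : Subgroup (A ≃ₗ[k] A) where
  carrier := {g | ∃ a b : Aˣ, g = lmul k a * rmul k b ∨ g = lmul k a * rmul k b * kappa n}
  one_mem' := ⟨1, 1, Or.inl (by ext x; simp [lmul, rmul])⟩
  mul_mem' := by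
    have h : ∀ a b c d : Aˣ, lmul k a * rmul k b * (lmul k c * rmul k d) =
        lmul k (a * c) * rmul k (d * b) := fun a b c d => by
      rw [lmul_mul, rmul_mul, mul_assoc, ← mul_assoc (rmul k b), ← lmul_rmul_comm]
      simp only [mul_assoc]
    have h' : ∀ c d : Aˣ, kappa n * (lmul k c * rmul k d) =
        lmul k (kappaUnit n d) * rmul k (kappaUnit n c) * kappa n := fun c d => by
      rw [← mul_assoc, kappa_mul_lmul, mul_assoc, kappa_mul_rmul, ← mul_assoc, lmul_rmul_comm]
    rintro _ _ ⟨a, b, rfl | rfl⟩ ⟨c, d, rfl | rfl⟩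
    · exact ⟨_, _, Or.inl (h a b c d)⟩
    · exact ⟨_, _, Or.inr (by rw [← h a b c d]; simp only [mul_assoc])⟩
    · exact ⟨_, _, Or.inr (by rw [mul_assoc, h', ← mul_assoc, h])⟩
    · refine ⟨a * kappaUnit n d, kappaUnit n c * b, Or.inl ?_⟩
      rw [mul_assoc, ← mul_assoc (kappa n), h', mul_assoc _ (kappa n), kappa_mul_kappa, mul_one, h]
  inv_mem' := by
    rintro _ ⟨a, b, rfl | rfl⟩
    · refine ⟨a⁻¹, b⁻¹, Or.inl ?_⟩
      rw [lmul_rmul_comm, mul_inv_rev, lmul_inv, rmul_inv]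
    · refine ⟨kappaUnit n b⁻¹, kappaUnit n a⁻¹, Or.inr ?_⟩
      rw [mul_inv_rev, lmul_rmul_comm, mul_inv_rev, ← lmul_inv, ← rmul_inv,
        inv_eq_of_mul_eq_one_right (kappa_mul_kappa n), ← mul_assoc, kappa_mul_lmul, mul_assoc,
        kappa_mul_rmul, ← mul_assoc, lmul_rmul_comm]

lemma lmul_mem_translationKappaGroup (a : Aˣ) : lmul k a ∈ translationKappaGroup n :=
  ⟨a, 1, Or.inl (by ext x; simp [lmul, rmul])⟩

lemma rmul_mem_translationKappaGroup (a : Aˣ) : rmul k a ∈ translationKappaGroup n :=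
  ⟨1, a, Or.inl (by ext x; simp [lmul, rmul])⟩

lemma kappa_mem_translationKappaGroup : kappa n ∈ translationKappaGroup n :=
  ⟨1, 1, Or.inr (by ext x; simp [lmul, rmul])⟩

/-- Linearise x κ(x) = n(x) and multiply by v on the right. Dividing by -n(v) gives the reflection
in v. -/
lemma mul_kappa_mul (x v : A) : v * kappa n x * v = polar n x v • v - n v • x := by
  have h : v * kappa n x = polar n x v • (1 : A) - x * kappa n v := by
    have h1 := mul_kappa_self n (x + v)
    rw [map_add, mul_add, add_mul, add_mul, mul_kappa_self, mul_kappa_self] at h1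
    have h2 : polar n x v • (1 : A) =
        algebraMap k A (n (x + v)) - algebraMap k A (n x) - algebraMap k A (n v) := by
      rw [← Algebra.algebraMap_eq_smul_one, polar, map_sub, map_sub]
    rw [h2, ← h1]
    abel
  rw [h, sub_mul, smul_mul_assoc, one_mul, mul_assoc, kappa_mul_self, ← Algebra.commutes,
    Algebra.smul_def (n v)]

omit [IsHurwitzNorm n] in
lemma map_sub_eq (x y : A) : n (x - y) = n x + n y - polar n x y := by
  have h : polar n x (-y) = n (x - y) - n x - n (-y) := by
    rw [sub_eq_add_neg x y]; rfl
  rw [QuadraticMap.polar_neg_right, QuadraticMap.map_neg] at h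
  linear_combination -h

/-- The reflection in an anisotropic vector belongs to `translationKappaGroup n`. -/
lemma exists_reflection {v : A} (hv : n v ≠ 0) :
    ∃ τ ∈ translationKappaGroup n, HasMultiplier n τ 1 ∧
      ∀ x, τ x = x - (polar n x v / n v) • v := by
  obtain ⟨w, rfl⟩ := isUnit_of_norm_ne_zero hv
  let c : kˣ := -(unitNorm n w)⁻¹
  let τ : A ≃ₗ[k] A :=
    lmul k (Units.map (algebraMap k A : k →* A) c) * (lmul k w * rmul k w * kappa n)
  have hτ : ∀ x, τ x = x - (polar n x w / n w) • (w : A) := by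
    intro x
    have e : τ x = (-(n (w : A))⁻¹) • ((w : A) * kappa n x * w) := by
      change (algebraMap k A (-((unitNorm n w)⁻¹ : kˣ) : k)) * (w * (kappa n x * w)) = _
      rw [← Algebra.smul_def, ← mul_assoc, Units.val_inv_eq_inv_val]
      rfl
    rw [e, mul_kappa_mul, smul_sub, smul_smul, smul_smul, neg_mul, neg_mul, inv_mul_cancel₀ hv,
      div_eq_inv_mul, neg_smul, neg_smul, one_smul]
    abel
  refine ⟨τ, ?_, fun x => ?_, hτ⟩
  · exact mul_mem (lmul_mem_translationKappaGroup n _)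
      (mul_mem (mul_mem (lmul_mem_translationKappaGroup n _) (rmul_mem_translationKappaGroup n _))
        (kappa_mem_translationKappaGroup n))
  · rw [hτ, map_sub_eq, QuadraticMap.map_smul, QuadraticMap.polar_smul_right, smul_eq_mul,
      smul_eq_mul, Units.val_one]
    field_simp
    ring

/-- An isometry can be corrected by a reflection so as to fix one more vector. -/
lemma exists_fixing {g : A ≃ₗ[k] A} (hg : HasMultiplier n g 1) {x : A}
    (hx : n (g x - x) = 0 → g x = x) :
    ∃ τ ∈ translationKappaGroup n, HasMultiplier n (τ * g) 1 ∧ (τ * g) x = x ∧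
      ∀ y, g y = y → (τ * g) y = y := by
  by_cases h : n (g x - x) = 0
  · exact ⟨1, one_mem _, by rwa [one_mul], hx h, fun y hy => hy⟩
  · obtain ⟨τ, hτ, hτ', e⟩ := exists_reflection n h
    have hgn : n (g x) = n x := by simpa using hg x
    refine ⟨τ, hτ, by simpa using hτ'.mul hg, ?_, fun y hy => ?_⟩
    -- Since n(gx) = n(x), the reflection in gx - x sends gx to x; vectors fixed by g are orthogonal
    -- to gx - x, hence stay fixed.
    · have : polar n (g x) (g x - x) = n (g x - x) := by
        rw [QuadraticMap.polar_sub_right, map_sub_eq, polar_self_eq, hgn]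
        ring
      rw [LinearEquiv.mul_apply, e, this, div_self h, one_smul, sub_sub_cancel]
    · have : polar n y (g x - x) = 0 := by
        have := hg.polar y x
        rw [hy, Units.val_one, one_mul] at this
        rw [QuadraticMap.polar_sub_right, this, sub_self]
      rw [LinearEquiv.mul_apply, hy, e, this, zero_div, zero_smul, sub_zero]

end Similitudes

/-! ### A basis 1, u, j, uj adapted to the norm. -/

section Frame

variable {k A : Type*} [Field k] [Ring A] [Algebra k A] (n : QuadraticForm k A) [IsHurwitzNorm n]

/-- If the discriminant vanished identically, then in characteristic two 1 would lie in the radical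
of the polar form; otherwise polarising shows that so would any nonzero x with ⟨x, 1⟩ = 0. -/
lemma exists_separable (hdim : Module.finrank k A = 4) :
    ∃ u : A, polar n u 1 ^ 2 - 4 * n u ≠ 0 := by
  have := IsHurwitzNorm.nontrivial (n := n)
  by_contra! H
  have hpol : ∀ x y, 2 * (polar n x 1 * polar n y 1 - 2 * polar n x y) = 0 := by
    intro x y
    have h := H (x + y)
    have e : n (x + y) = n x + n y + polar n x y := by rw [polar]; ring
    rw [e, QuadraticMap.polar_add_left] at h
    linear_combination h - H x - H y
  by_cases h2 : (2 : k) = 0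
  · refine one_ne_zero (IsHurwitzNorm.nondegenerate (n := n) (1 : A) fun y => ?_)
    rw [QuadraticMap.polar_comm]
    refine pow_eq_zero_iff (two_ne_zero) |>.mp ?_
    linear_combination H y + 2 * n y * h2
  · obtain ⟨x, hx, hx0⟩ : ∃ x : A, polar n x 1 = 0 ∧ x ≠ 0 := by
      have hker : LinearMap.ker (n.polarBilin.flip 1) ≠ ⊥ := by
        have : FiniteDimensional k A := FiniteDimensional.of_finrank_pos (by omega)
        refine LinearMap.ker_ne_bot_of_finrank_lt ?_
        rw [hdim, Module.finrank_self]; norm_num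
      obtain ⟨x, hx, hx0⟩ := Submodule.exists_mem_ne_zero_of_ne_bot hker
      exact ⟨x, hx, hx0⟩
    refine hx0 (IsHurwitzNorm.nondegenerate (n := n) x fun y => ?_)
    have h := hpol x y
    rw [hx] at h
    have h4 : (2 : k) * 2 ≠ 0 := mul_ne_zero h2 h2
    exact (mul_eq_zero.mp (show (2 : k) * 2 * polar n x y = 0 by linear_combination -h)).resolve_left
      h4

/-- The Gram matrix of 1, u is invertible, so A projects onto their orthogonal complement. If n
vanished there, the complement would lie in the radical, hence be zero, and 1, u would span A. -/
lemma exists_orthogonal (hdim : Module.finrank k A = 4) {u : A}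
    (hu : polar n u 1 ^ 2 - 4 * n u ≠ 0) :
    ∃ j : A, polar n j 1 = 0 ∧ polar n j u = 0 ∧ n j ≠ 0 := by
  by_contra! H
  have hone : polar n (1 : A) 1 = 2 := by rw [polar_self_eq, norm_one, mul_one]
  have hproj : ∀ y : A, ∃ α β : k, polar n (y - (α • 1 + β • u)) 1 = 0 ∧
      polar n (y - (α • 1 + β • u)) u = 0 := by
    intro y
    obtain ⟨d, hd⟩ : ∃ d, (polar n u 1 ^ 2 - 4 * n u) * d = 1 := ⟨_, mul_inv_cancel₀ hu⟩
    -- Cramer's rule for the Gram system of 1, u.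
    refine ⟨(polar n u 1 * polar n y u - 2 * n u * polar n y 1) * d,
      (polar n u 1 * polar n y 1 - 2 * polar n y u) * d, ?_, ?_⟩
    · simp only [QuadraticMap.polar_sub_left, QuadraticMap.polar_add_left,
        QuadraticMap.polar_smul_left, hone, smul_eq_mul]
      linear_combination -polar n y 1 * hd
    · simp only [QuadraticMap.polar_sub_left, QuadraticMap.polar_add_left,
        QuadraticMap.polar_smul_left, polar_self_eq n u, smul_eq_mul,
        QuadraticMap.polar_comm n 1 u]
      linear_combination -polar n y u * hd
  have hzero : ∀ x : A, polar n x 1 = 0 → polar n x u = 0 → x = 0 := by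
    intro x h1 hu
    refine IsHurwitzNorm.nondegenerate (n := n) x fun y => ?_
    obtain ⟨α, β, e1, eu⟩ := hproj y
    set y' := y - (α • 1 + β • u)
    have hxy : polar n x y' = 0 := by
      rw [polar, H x h1 hu, H y' e1 eu, H (x + y') (by rw [QuadraticMap.polar_add_left, h1, e1,
        add_zero]) (by rw [QuadraticMap.polar_add_left, hu, eu, add_zero])]
      simp
    have : y = y' + (α • 1 + β • u) := by simp [y']
    rw [this, QuadraticMap.polar_add_right, QuadraticMap.polar_add_right,
      QuadraticMap.polar_smul_right, QuadraticMap.polar_smul_right, hxy, h1, hu]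
    simp
  have hsurj : Function.Surjective
      ((LinearMap.toSpanSingleton k A 1).coprod (LinearMap.toSpanSingleton k A u)) := by
    intro y
    obtain ⟨α, β, e1, eu⟩ := hproj y
    exact ⟨(α, β), (sub_eq_zero.mp (hzero _ e1 eu)).symm⟩
  have := LinearMap.finrank_le_finrank_of_surjective hsurj
  rw [hdim, Module.finrank_prod, Module.finrank_self] at this
  omega

variable {n} {u j : A}

lemma eq_zero_of_gram {t N α β : k} (hΔ : t ^ 2 - 4 * N ≠ 0) (h1 : 2 * α + t * β = 0)
    (h2 : t * α + 2 * N * β = 0) : α = 0 ∧ β = 0 := by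
  constructor
  · exact (mul_eq_zero.mp (show (t ^ 2 - 4 * N) * α = 0 by
      linear_combination t * h2 - 2 * N * h1)).resolve_left hΔ
  · exact (mul_eq_zero.mp (show (t ^ 2 - 4 * N) * β = 0 by
      linear_combination t * h1 - 2 * h2)).resolve_left hΔ

/-- The pairings of `α + β u + γ j + δ u j` with `1`, `u`, `j` and `u j`. -/
lemma polar_combination (h1 : polar n j 1 = 0) (hju : polar n j u = 0) (α β γ δ : k) :
    polar n (α • 1 + β • u + γ • j + δ • (u * j)) 1 = 2 * α + polar n u 1 * β ∧
    polar n (α • 1 + β • u + γ • j + δ • (u * j)) u = polar n u 1 * α + 2 * n u * β ∧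
    polar n (α • 1 + β • u + γ • j + δ • (u * j)) j = n j * (2 * γ + polar n u 1 * δ) ∧
    polar n (α • 1 + β • u + γ • j + δ • (u * j)) (u * j) =
      n j * (polar n u 1 * γ + 2 * n u * δ) := by
  have hone : polar n (1 : A) 1 = 2 := by rw [polar_self_eq, norm_one, mul_one]
  have hk : kappa n j = -j := by rw [kappa_apply, h1, zero_smul, zero_sub]
  have e1 : polar n (u * j) 1 = 0 := by
    rw [polar_mul_right, one_mul, hk, QuadraticMap.polar_neg_right, QuadraticMap.polar_comm, hju,
      neg_zero]
  have eu : polar n (u * j) u = 0 := by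
    have := polar_mul_mul_left n u j 1
    rwa [mul_one, h1, mul_zero] at this
  have ej : polar n (u * j) j = polar n u 1 * n j := by
    have := polar_mul_mul_right n u 1 j
    rwa [one_mul] at this
  have euj : polar n (u * j) (u * j) = 2 * (n u * n j) := by
    rw [polar_self_eq, IsHurwitzNorm.map_mul (n := n)]
  simp only [QuadraticMap.polar_add_left, QuadraticMap.polar_smul_left, smul_eq_mul, hone, h1, hju,
    e1, eu, ej, euj, polar_self_eq n u, polar_self_eq n j, QuadraticMap.polar_comm n 1 u,
    QuadraticMap.polar_comm n 1 j, QuadraticMap.polar_comm n u j,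
    QuadraticMap.polar_comm n j (u * j), QuadraticMap.polar_comm n 1 (u * j),
    QuadraticMap.polar_comm n u (u * j)]
  refine ⟨?_, ?_, ?_, ?_⟩ <;> ring

/-- The Gram matrix of 1, u, j, uj has two diagonal blocks, that of 1, u and its multiple by n(j),
so it is invertible. -/
lemma exists_combination (hdim : Module.finrank k A = 4) (hu : polar n u 1 ^ 2 - 4 * n u ≠ 0)
    (h1 : polar n j 1 = 0) (hju : polar n j u = 0) (hj : n j ≠ 0) (x : A) :
    ∃ α β γ δ : k, x = α • 1 + β • u + γ • j + δ • (u * j) := by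
  have hli : LinearIndependent k ![1, u, j, u * j] := by
    rw [Fintype.linearIndependent_iff]
    intro c hc
    rw [Fin.sum_univ_four] at hc
    change c 0 • (1 : A) + c 1 • u + c 2 • j + c 3 • (u * j) = 0 at hc
    obtain ⟨p1, pu, pj, puj⟩ := polar_combination h1 hju (c 0) (c 1) (c 2) (c 3)
    rw [hc, QuadraticMap.polar_zero_left, eq_comm] at p1 pu pj puj
    obtain ⟨c0, c1⟩ := eq_zero_of_gram hu p1 pu
    obtain ⟨c2, c3⟩ := eq_zero_of_gram hu ((mul_eq_zero.mp pj).resolve_left hj)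
      ((mul_eq_zero.mp puj).resolve_left hj)
    intro i
    fin_cases i <;> assumption
  let b := basisOfLinearIndependentOfCardEqFinrank hli (by simp [hdim])
  have hb : ⇑b = ![1, u, j, u * j] := coe_basisOfLinearIndependentOfCardEqFinrank hli _
  refine ⟨b.repr x 0, b.repr x 1, b.repr x 2, b.repr x 3, ?_⟩
  have h := b.sum_repr x
  rw [Fin.sum_univ_four, hb] at h
  exact h.symm

/-- A vector isotropic and orthogonal to `1`, `u` and `j` vanishes. -/
lemma eq_zero_of_isotropic (hdim : Module.finrank k A = 4) (hu : polar n u 1 ^ 2 - 4 * n u ≠ 0)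
    (h1 : polar n j 1 = 0) (hju : polar n j u = 0) (hj : n j ≠ 0) {z : A} (z1 : polar n z 1 = 0)
    (zu : polar n z u = 0) (zj : polar n z j = 0) (hz : n z = 0) : z = 0 := by
  obtain ⟨α, β, γ, δ, rfl⟩ := exists_combination hdim hu h1 hju hj z
  obtain ⟨p1, pu, pj, -⟩ := polar_combination h1 hju α β γ δ
  rw [z1, eq_comm] at p1
  rw [zu, eq_comm] at pu
  rw [zj, eq_comm] at pj
  obtain ⟨rfl, rfl⟩ := eq_zero_of_gram hu p1 pu
  have pj' := (mul_eq_zero.mp pj).resolve_left hj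
  rw [zero_smul, zero_smul, zero_add, zero_add] at hz ⊢
  have e : γ • j + δ • (u * j) = (γ • 1 + δ • u) * j := by
    rw [add_mul, smul_mul_assoc, smul_mul_assoc, one_mul]
  rw [e, IsHurwitzNorm.map_mul (n := n)] at hz
  have hz' := (mul_eq_zero.mp hz).resolve_right hj
  have e2 : n (γ • 1 + δ • u) = γ ^ 2 + γ * δ * polar n u 1 + δ ^ 2 * n u := by
    have : n (γ • 1 + δ • u) = n (γ • (1 : A)) + n (δ • u) + polar n (γ • (1 : A)) (δ • u) := by
      rw [polar]; ring
    rw [this, QuadraticMap.map_smul, QuadraticMap.map_smul, QuadraticMap.polar_smul_left,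
      QuadraticMap.polar_smul_right, norm_one, QuadraticMap.polar_comm]
    simp only [smul_eq_mul]
    ring
  rw [e2] at hz'
  -- Completes the square, with t = ⟨u, 1⟩: 4 n(γ + δu) = (2γ + tδ)² - (t² - 4n(u))δ².
  obtain rfl : δ = 0 := by
    have : (polar n u 1 ^ 2 - 4 * n u) * δ ^ 2 = 0 := by
      linear_combination -4 * hz' + (2 * γ + polar n u 1 * δ) * pj'
    simpa using (mul_eq_zero.mp this).resolve_left hu
  obtain rfl : γ = 0 := by simpa using hz'
  simp

end Frame

/-! ### Classification of similitudes. -/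

section Classification

variable {k A : Type*} [Field k] [Ring A] [Algebra k A] (n : QuadraticForm k A) [IsHurwitzNorm n]

/-- Every isometry fixing `1` is of the form `x ↦ a x b` or `x ↦ a κ(x) b`. -/
lemma mem_translationKappaGroup_of_isometry (hdim : Module.finrank k A = 4) {g : A ≃ₗ[k] A}
    (hg : HasMultiplier n g 1) (g1 : g 1 = 1) : g ∈ translationKappaGroup n := by
  obtain ⟨u, hu⟩ := exists_separable n hdim
  obtain ⟨j, h1, hju, hj⟩ := exists_orthogonal n hdim hu
  have hfix : ∀ {h : A ≃ₗ[k] A}, HasMultiplier n h 1 → ∀ x y, h y = y →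
      polar n (h x - x) y = 0 := by
    intro h hh x y hy
    have := hh.polar x y
    rw [hy, Units.val_one, one_mul] at this
    rw [QuadraticMap.polar_sub_left, this, sub_self]
  have hself : ∀ {h : A ≃ₗ[k] A}, HasMultiplier n h 1 → ∀ x,
      n (h x - x) = 2 * n x - polar n (h x) x := by
    intro h hh x
    have : n (h x) = n x := by simpa using hh x
    rw [map_sub_eq, this]
    ring
  obtain ⟨τ₁, hτ₁, hg₁, gu, g1'⟩ : ∃ τ ∈ translationKappaGroup n, HasMultiplier n (τ * g) 1 ∧
      (τ * g) u = u ∧ (τ * g) 1 = 1 := by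
    -- Both κg and g fix 1, and n(gu - u) + n(κgu - u) = 4n(u) - ⟨u, 1⟩² ≠ 0, so at least one of
    -- them can be corrected by a reflection to fix u.
    by_cases h0 : n (g u - u) = 0
    · have hk : HasMultiplier n (kappa n * g) 1 := fun x => by
        rw [LinearEquiv.mul_apply, map_kappa, hg]
      have hk0 : n ((kappa n * g) u - u) ≠ 0 := by
        intro h
        rw [hself hg] at h0
        rw [hself hk, LinearEquiv.mul_apply, kappa_apply, QuadraticMap.polar_sub_left,
          QuadraticMap.polar_smul_left, QuadraticMap.polar_comm n 1 u, smul_eq_mul] at h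
        have := hg.polar u 1
        rw [g1, Units.val_one, one_mul] at this
        rw [this] at h
        exact hu (by linear_combination -h - h0)
      obtain ⟨τ, hτ, hm, hx, hy⟩ := exists_fixing n hk (x := u) fun h => absurd h hk0
      refine ⟨τ * kappa n, mul_mem hτ (kappa_mem_translationKappaGroup n), by rwa [mul_assoc],
        by rwa [mul_assoc], ?_⟩
      rw [mul_assoc]
      exact hy 1 (by rw [LinearEquiv.mul_apply, g1, kappa_one])
    · obtain ⟨τ, hτ, hm, hx, hy⟩ := exists_fixing n hg (x := u) fun h => absurd h h0
      exact ⟨τ, hτ, hm, hx, hy 1 g1⟩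
  -- The difference gj - j is orthogonal to 1 and u. If isotropic it is also orthogonal to j,
  -- because ⟨gj - j, j⟩ = -n(gj - j); it is then zero.
  obtain ⟨τ₂, hτ₂, hg₂, gj, gfix₂⟩ := exists_fixing n hg₁ (x := j) fun h =>
    sub_eq_zero.mp <| eq_zero_of_isotropic hdim hu h1 hju hj (hfix hg₁ _ _ g1') (hfix hg₁ _ _ gu)
      (by
        rw [hself hg₁] at h
        rw [QuadraticMap.polar_sub_left, polar_self_eq]
        linear_combination -h) h
  have gu₂ := gfix₂ u gu
  have g1₂ := gfix₂ 1 g1'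
  obtain ⟨τ₃, hτ₃, hg₃, guj, gfix₃⟩ := exists_fixing n hg₂ (x := u * j) fun h =>
    sub_eq_zero.mp <| eq_zero_of_isotropic hdim hu h1 hju hj (hfix hg₂ _ _ g1₂)
      (hfix hg₂ _ _ gu₂) (hfix hg₂ _ _ gj) h
  have hone : τ₃ * (τ₂ * (τ₁ * g)) = 1 := by
    ext x
    obtain ⟨α, β, γ, δ, rfl⟩ := exists_combination hdim hu h1 hju hj x
    simp only [map_add, map_smul, gfix₃ 1 g1₂, gfix₃ u gu₂, gfix₃ j gj, guj]
    rfl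
  rw [← mul_assoc, ← mul_assoc] at hone
  rw [eq_inv_of_mul_eq_one_right hone]
  exact inv_mem (mul_mem (mul_mem hτ₃ hτ₂) hτ₁)

/-- Every similitude of a quaternion algebra is of the form `x ↦ a x b` or `x ↦ a κ(x) b`. -/
theorem mem_translationKappaGroup_of_mem_GO (hdim : Module.finrank k A = 4) {g : A ≃ₗ[k] A}
    (hg : g ∈ GO n) : g ∈ translationKappaGroup n := by
  obtain ⟨μ, hμ⟩ := hg
  have hn : n (g 1) = μ := by rw [hμ, norm_one, mul_one]
  obtain ⟨a, ha⟩ := isUnit_of_norm_ne_zero (n := n) (x := g 1) (by rw [hn]; exact μ.ne_zero)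
  have hm : unitNorm n a = μ := Units.ext (by rw [← hn, ← ha]; rfl)
  have hiso := (lmul_hasMultiplier n a).inv.mul hμ
  rw [hm, inv_mul_cancel] at hiso
  have h := mem_translationKappaGroup_of_isometry n hdim hiso (by
    rw [LinearEquiv.mul_apply, ← ha, ← lmul_inv]
    exact a.inv_mul)
  exact (Subgroup.mul_mem_cancel_left _
    (inv_mem (lmul_mem_translationKappaGroup n a))).mp h

end Classification

/-! ### PGO(A), triality and the action on X_A in terms of (A^*/k^*)². -/

section Bitranslations

variable {k A : Type*} [Field k] [Ring A] [Algebra k A]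

lemma pcl_eq_one_iff {g : A ≃ₗ[k] A} : pcl g = 1 ↔ ∃ c : kˣ, ∀ x, g x = c • x := by
  rw [pcl, QuotientGroup.eq_one_iff]
  constructor
  · rintro ⟨c, rfl⟩
    exact ⟨c, fun x => rfl⟩
  · rintro ⟨c, hc⟩
    exact ⟨c, LinearEquiv.ext fun x => (hc x).symm⟩

variable (k A) in
/-- The homomorphism `a ↦ L_a` from `A^*/k^*` to `PGL(A)`. -/
noncomputable def leftHom : PUnits k A →* PGL k A :=
  QuotientGroup.lift _
    { toFun := fun a => pcl (lmul k a)
      map_one' := pcl_eq_one_iff.mpr ⟨1, fun x => by simp [lmul]⟩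
      map_mul' := fun a b => by rw [lmul_mul, pcl_mul] } (by
    rintro _ ⟨c, rfl⟩
    exact pcl_eq_one_iff.mpr ⟨c, fun x => (Algebra.smul_def (c : k) x).symm⟩)

variable (k A) in
/-- The homomorphism `a ↦ R_a⁻¹` from `A^*/k^*` to `PGL(A)`. -/
noncomputable def rightHom : PUnits k A →* PGL k A :=
  QuotientGroup.lift _
    { toFun := fun a => (pcl (rmul k a))⁻¹
      map_one' := inv_eq_one.mpr (pcl_eq_one_iff.mpr ⟨1, fun x => by simp [rmul]⟩)
      map_mul' := fun a b => by rw [rmul_mul, pcl_mul, mul_inv_rev] } (by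
    rintro _ ⟨c, rfl⟩
    refine inv_eq_one.mpr (pcl_eq_one_iff.mpr ⟨c, fun x => ?_⟩)
    exact (Algebra.commutes (c : k) x).symm.trans (Algebra.smul_def (c : k) x).symm)

lemma leftHom_ucl (a : Aˣ) : leftHom k A (ucl k a) = pcl (lmul k a) := rfl

lemma rightHom_ucl (a : Aˣ) : rightHom k A (ucl k a) = (pcl (rmul k a))⁻¹ := rfl

lemma ucl_surjective (a : PUnits k A) : ∃ a' : Aˣ, ucl k a' = a := QuotientGroup.mk_surjective a

lemma ucl_inv (a : Aˣ) : ucl k a⁻¹ = (ucl k a)⁻¹ := rfl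

variable (k A) in
/-- The homomorphism from `(A^*/k^*)²` to `PGL(A)` mapping `(a, b)` to the class of
`x ↦ a x b⁻¹`. -/
noncomputable def biHom : PUnits k A × PUnits k A →* PGL k A :=
  (leftHom k A).noncommCoprod (rightHom k A) (by
    intro a b
    obtain ⟨a, rfl⟩ := ucl_surjective a
    obtain ⟨b, rfl⟩ := ucl_surjective b
    rw [leftHom_ucl, rightHom_ucl]
    refine Commute.inv_right ?_
    rw [Commute, SemiconjBy, ← pcl_mul, ← pcl_mul, lmul_rmul_comm])

lemma biHom_apply (a b : PUnits k A) : biHom k A (a, b) = leftHom k A a * rightHom k A b := rfl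

lemma biHom_ucl (a b : Aˣ) :
    biHom k A (ucl k a, ucl k b) = pcl (lmul k a) * (pcl (rmul k b))⁻¹ := rfl

/-- If a x b⁻¹ = c x for all x, then x = 1 gives a = cb, so b commutes with everything and both are
scalars. -/
lemma biHom_injective [Algebra.IsCentral k A] : Function.Injective (biHom k A) := by
  rw [injective_iff_map_eq_one]
  rintro ⟨a, b⟩ h
  obtain ⟨a, rfl⟩ := ucl_surjective a
  obtain ⟨b, rfl⟩ := ucl_surjective b
  rw [biHom_ucl, ← pcl_inv, ← pcl_mul, pcl_eq_one_iff] at h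
  obtain ⟨c, hc⟩ := h
  have hc' : ∀ x : A, a * x = c • (x * b) := fun x => by
    have : (a : A) * (x * (b⁻¹ : Aˣ)) = c • x := hc x
    rw [← smul_mul_assoc, ← this, mul_assoc, Units.inv_mul_cancel_right]
  have ha : (a : A) = c • (b : A) := by simpa using hc' 1
  have hb : ∀ x : A, b * x = x * b := fun x => by
    have := hc' x
    rw [ha, smul_mul_assoc] at this
    exact smul_left_cancel c this
  obtain ⟨r, hr⟩ := (Algebra.IsCentral.mem_center_iff k).mp
    (Subalgebra.mem_center_iff.mpr fun x => (hb x).symm)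
  by_cases hA : Subsingleton A
  · have : ∀ u : Aˣ, ucl k u = 1 := fun u => by
      rw [Units.ext (Subsingleton.elim (u : A) (1 : Aˣ))]; rfl
    rw [this, this]; rfl
  rw [not_subsingleton_iff_nontrivial] at hA
  have hr0 : r ≠ 0 := by
    rintro rfl
    rw [map_zero] at hr
    exact b.ne_zero hr
  have hb1 : ucl k b = 1 := (QuotientGroup.eq_one_iff _).mpr
    ⟨Units.mk0 r hr0, Units.ext hr.symm⟩
  have ha1 : ucl k a = 1 := by
    refine (QuotientGroup.eq_one_iff _).mpr ⟨c * Units.mk0 r hr0, Units.ext ?_⟩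
    rw [ha, hr, Units.smul_def, Algebra.smul_def, ← map_mul]
    rfl
  rw [ha1, hb1]; rfl

lemma pcl_innerAut (s : Aˣ) : pcl (innerAut k s) = biHom k A (ucl k s, ucl k s) := rfl

lemma xcl_eq_iff {α β α' β' : PGL k A} : xcl α β = xcl α' β' ↔
    ∃ w : PUnits k A, α' = biHom k A (1, w) * α ∧ β' = biHom k A (w, 1) * β := by
  have h1 : ∀ w : Aˣ, biHom k A (1, ucl k w) = (pcl (rmul k w))⁻¹ := fun w => by
    rw [biHom_apply, map_one, one_mul, rightHom_ucl]
  have h2 : ∀ w : Aˣ, biHom k A (ucl k w, 1) = pcl (lmul k w) := fun w => by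
    rw [biHom_apply, map_one, mul_one, leftHom_ucl]
  constructor
  · intro h
    obtain ⟨w, hw⟩ := Quotient.exact h
    obtain ⟨hα, hβ⟩ := Prod.mk.inj hw
    exact ⟨ucl k w, by rw [h1]; exact hα, by rw [h2]; exact hβ⟩
  · rintro ⟨w, rfl, rfl⟩
    obtain ⟨w, rfl⟩ := ucl_surjective w
    rw [h1, h2, xcl_nuclear]

variable (n : QuadraticForm k A) [IsHurwitzNorm n]

/-- Projectively κ(a) is a⁻¹, since a κ(a) is the scalar n(a). -/
lemma pcl_rmul_kappaUnit (a : Aˣ) : pcl (rmul k (kappaUnit n a)) = (pcl (rmul k a))⁻¹ := by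
  rw [eq_inv_iff_mul_eq_one, ← pcl_mul, pcl_eq_one_iff]
  refine ⟨unitNorm n a, fun x => ?_⟩
  change x * a * kappa n a = n (a : A) • x
  rw [mul_assoc, mul_kappa_self, Algebra.smul_def, Algebra.commutes]

lemma pcl_lmul_kappaUnit (a : Aˣ) : pcl (lmul k (kappaUnit n a)) = (pcl (lmul k a))⁻¹ := by
  rw [eq_inv_iff_mul_eq_one, ← pcl_mul, pcl_eq_one_iff]
  refine ⟨unitNorm n a, fun x => ?_⟩
  change kappa n a * (a * x) = n (a : A) • x
  rw [← mul_assoc, kappa_mul_self, Algebra.smul_def]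

/-- Conjugation by `κ` exchanges the two factors of `(A^*/k^*)²`. -/
lemma pcl_kappa_mul_biHom (z : PUnits k A × PUnits k A) :
    pcl (kappa n) * biHom k A z = biHom k A z.swap * pcl (kappa n) := by
  obtain ⟨a, b⟩ := z
  obtain ⟨a, rfl⟩ := ucl_surjective a
  obtain ⟨b, rfl⟩ := ucl_surjective b
  rw [Prod.swap_prod_mk, biHom_ucl, biHom_ucl, ← pcl_rmul_kappaUnit n a, ← pcl_inv, ← rmul_inv,
    ← pcl_mul, ← pcl_mul, ← pcl_mul, ← pcl_mul, ← mul_assoc, kappa_mul_lmul, mul_assoc,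
    kappa_mul_rmul, ← mul_assoc, ← lmul_rmul_comm, pcl_mul, pcl_mul, pcl_lmul_kappaUnit, ← pcl_inv,
    ← lmul_inv, inv_inv, pcl_mul, pcl_mul]

lemma biHom_eq_iff [Algebra.IsCentral k A] {x y z w : PUnits k A × PUnits k A} :
    biHom k A x = biHom k A y * biHom k A z * (biHom k A w)⁻¹ ↔ x = y * z * w⁻¹ := by
  rw [← map_inv, ← map_mul, ← map_mul, biHom_injective.eq_iff]

lemma biHom_mul_kappa_eq_iff [Algebra.IsCentral k A] {x y z w : PUnits k A × PUnits k A} :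
    biHom k A x * pcl (kappa n) =
      biHom k A y * (biHom k A z * pcl (kappa n)) * (biHom k A w)⁻¹ ↔ x = y * z * w.swap⁻¹ := by
  rw [← map_inv, ← mul_assoc, mul_assoc (biHom k A y * biHom k A z), pcl_kappa_mul_biHom,
    ← mul_assoc, mul_left_inj, ← map_mul, ← map_mul, biHom_injective.eq_iff]
  rfl

variable (hdim : Module.finrank k A = 4)
include hdim

lemma lmul_mul_rmul_mem_GOplus (a b : Aˣ) : lmul k a * rmul k b ∈ GOplus n :=
  have : FiniteDimensional k A := FiniteDimensional.of_finrank_pos (by omega)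
  mul_mem (lmul_mem_GOplus n hdim a) (rmul_mem_GOplus n hdim b)

lemma lmul_mul_rmul_mul_kappa_notMem_GOplus (a b : Aˣ) :
    lmul k a * rmul k b * kappa n ∉ GOplus n := by
  have : FiniteDimensional k A := FiniteDimensional.of_finrank_pos (by omega)
  rw [Subgroup.mul_mem_cancel_left _ (lmul_mul_rmul_mem_GOplus n hdim a b)]
  exact kappa_notMem_GOplus n hdim

omit [IsHurwitzNorm n] hdim in
lemma GOplus_le_GO : GOplus n ≤ GO n := fun _ ⟨μ, hμ⟩ => ⟨μ, hμ.1⟩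

lemma mem_GOplus_iff {g : A ≃ₗ[k] A} :
    g ∈ GOplus n ↔ ∃ a b : Aˣ, g = lmul k a * rmul k b := by
  constructor
  · intro hg
    obtain ⟨a, b, rfl | rfl⟩ := mem_translationKappaGroup_of_mem_GO n hdim (GOplus_le_GO n hg)
    · exact ⟨a, b, rfl⟩
    · exact absurd hg (lmul_mul_rmul_mul_kappa_notMem_GOplus n hdim a b)
  · rintro ⟨a, b, rfl⟩
    exact lmul_mul_rmul_mem_GOplus n hdim a b

omit [IsHurwitzNorm n] hdim in
lemma pcl_lmul_mul_rmul (a b : Aˣ) :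
    pcl (lmul k a * rmul k b) = biHom k A (ucl k a, (ucl k b)⁻¹) := by
  rw [← ucl_inv, biHom_ucl, rmul_inv, pcl_inv, inv_inv, pcl_mul]

lemma mem_PGOplus_iff {φ : PGL k A} : φ ∈ PGOplus n ↔ ∃ z, φ = biHom k A z := by
  constructor
  · rintro ⟨g, hg, rfl⟩
    obtain ⟨a, b, rfl⟩ := (mem_GOplus_iff n hdim).mp hg
    exact ⟨_, pcl_lmul_mul_rmul a b⟩
  · rintro ⟨⟨a, b⟩, rfl⟩
    obtain ⟨a, rfl⟩ := ucl_surjective a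
    obtain ⟨b, rfl⟩ := ucl_surjective b
    exact ⟨_, lmul_mul_rmul_mem_GOplus n hdim a b⁻¹, by
      rw [← inv_inv (ucl k b), ← ucl_inv, ← pcl_lmul_mul_rmul]; rfl⟩

lemma mem_PGOsign_one_iff {φ : PGL k A} : φ ∈ PGOsign n 1 ↔ ∃ z, φ = biHom k A z := by
  rw [← mem_PGOplus_iff n hdim, PGOsign, if_pos rfl]
  rfl

lemma mem_PGOsign_neg_one_iff {φ : PGL k A} :
    φ ∈ PGOsign n (-1) ↔ ∃ z, φ = biHom k A z * pcl (kappa n) := by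
  rw [PGOsign, if_neg (by decide)]
  constructor
  · rintro ⟨g, ⟨hg, hg'⟩, rfl⟩
    obtain ⟨a, b, rfl | rfl⟩ := mem_translationKappaGroup_of_mem_GO n hdim hg
    · exact absurd (lmul_mul_rmul_mem_GOplus n hdim a b) hg'
    · exact ⟨_, by rw [pcl_mul, pcl_lmul_mul_rmul]⟩
  · rintro ⟨⟨a, b⟩, rfl⟩
    obtain ⟨a, rfl⟩ := ucl_surjective a
    obtain ⟨b, rfl⟩ := ucl_surjective b
    refine ⟨lmul k a * rmul k b⁻¹ * kappa n, ⟨?_, ?_⟩, ?_⟩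
    · exact mul_mem (mul_mem (lmul_mem_GO n a) (rmul_mem_GO n _)) (kappa_mem_GO n)
    · exact lmul_mul_rmul_mul_kappa_notMem_GOplus n hdim a b⁻¹
    · rw [pcl_mul, pcl_lmul_mul_rmul, ucl_inv, inv_inv]

/-- The triality components of `x ↦ p x q⁻¹` are `x ↦ p x r⁻¹` and `x ↦ r x q⁻¹`. -/
lemma IsTriality.exists_biHom {f f₁ f₂ : A ≃ₗ[k] A} (hf : f ∈ GOplus n)
    (h : IsTriality n f f₁ f₂) : ∃ p q r : PUnits k A,
      pcl f = biHom k A (p, q) ∧ pcl f₁ = biHom k A (p, r) ∧ pcl f₂ = biHom k A (r, q) := by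
  obtain ⟨a, b, rfl⟩ := (mem_GOplus_iff n hdim).mp hf
  obtain ⟨μ, hμ⟩ := h.mem₂
  -- The value c = f₂(1) is the only freedom: y = 1 in the triality relation determines f₁, and x =
  -- 1 then determines f₂.
  obtain ⟨c, hc⟩ := isUnit_of_norm_ne_zero (n := n) (x := f₂ 1)
    (by rw [hμ, norm_one, mul_one]; exact μ.ne_zero)
  have h1 : f₁ = lmul k a * rmul k (b * c⁻¹) := by
    ext x
    have e : (a : A) * (x * 1 * b) = f₁ x * f₂ 1 := h.map_mul x 1
    change f₁ x = a * (x * ((b * c⁻¹ : Aˣ) : A))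
    rw [← hc, mul_one] at e
    rw [Units.val_mul, ← mul_assoc x, ← mul_assoc (a : A), e, Units.mul_inv_cancel_right]
  have h2 : f₂ = lmul k (c * b⁻¹) * rmul k b := by
    ext x
    have e : (a : A) * (1 * x * b) = f₁ 1 * f₂ x := h.map_mul 1 x
    have e' : f₁ 1 = ((a * (b * c⁻¹) : Aˣ) : A) := by
      rw [h1]
      change (a : A) * (1 * ((b * c⁻¹ : Aˣ) : A)) = _
      rw [one_mul, ← Units.val_mul]
    rw [e', one_mul, Units.val_mul, mul_assoc] at e
    change f₂ x = (c * b⁻¹ : Aˣ) * (x * b)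
    rw [a.isUnit.mul_right_inj.mp e, ← mul_assoc, ← Units.val_mul]
    simp
  exact ⟨_, _, (ucl k (b * c⁻¹))⁻¹, pcl_lmul_mul_rmul a b, by rw [h1, pcl_lmul_mul_rmul], by
    rw [h2, pcl_lmul_mul_rmul, ← ucl_inv (b * c⁻¹), mul_inv_rev, inv_inv]⟩

/-- The action of `PGO⁺(A)` on `X_A` in terms of `biHom`. -/
lemma actsTo_xcl_iff {φ α β α' β' : PGL k A} : ActsTo n φ (xcl α β) (xcl α' β') ↔
    ∃ p q r : PUnits k A, φ = biHom k A (p, q) ∧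
      α' = biHom k A (p, r) * α * (biHom k A (p, q))⁻¹ ∧
      β' = biHom k A (r, q) * β * (biHom k A (p, q))⁻¹ := by
  constructor
  · rintro ⟨f, hf, rfl, f₁, f₂, h, γ, δ, hx, hy⟩
    obtain ⟨p, q, r, e, e₁, e₂⟩ := h.exists_biHom n hdim hf
    obtain ⟨v, rfl, rfl⟩ := xcl_eq_iff.mp hx
    obtain ⟨w, rfl, rfl⟩ := xcl_eq_iff.mp hy.symm
    -- The free parameter r absorbs the changes of representative v (source) and w (target).
    refine ⟨p, q, w * r * v, e, ?_, ?_⟩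
    · rw [e, e₁, ← mul_assoc, ← mul_assoc, ← mul_assoc, ← map_mul, ← map_mul]
      simp
    · rw [e, e₂, ← mul_assoc, ← mul_assoc, ← mul_assoc, ← map_mul, ← map_mul]
      simp
  · rintro ⟨p, q, r, rfl, rfl, rfl⟩
    obtain ⟨p, rfl⟩ := ucl_surjective p
    obtain ⟨q, rfl⟩ := ucl_surjective q
    obtain ⟨r, rfl⟩ := ucl_surjective r
    have hT : ∀ a b : Aˣ, pcl (lmul k a * rmul k b⁻¹) = biHom k A (ucl k a, ucl k b) := by
      intro a b
      rw [pcl_lmul_mul_rmul, ucl_inv, inv_inv]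
    have hG := fun a b => GOplus_le_GO n (lmul_mul_rmul_mem_GOplus n hdim a b)
    refine ⟨_, lmul_mul_rmul_mem_GOplus n hdim p q⁻¹, hT p q, lmul k p * rmul k r⁻¹,
      lmul k r * rmul k q⁻¹, ⟨hG _ _, hG _ _, fun x y => ?_⟩, α, β, rfl, by rw [hT, hT]⟩
    change (p : A) * (x * y * (q⁻¹ : Aˣ)) = p * (x * (r⁻¹ : Aˣ)) * (r * (y * (q⁻¹ : Aˣ)))
    rw [← mul_assoc _ (r : A), mul_assoc (p : A), Units.inv_mul_cancel_right]
    simp only [mul_assoc]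

end Bitranslations

/-! ### The functor on normal forms and its equivalence property. -/

section Equivalence

variable {k A : Type*} [Field k] [Ring A] [Algebra k A]
  (n : QuadraticForm k A) [IsHurwitzNorm n]

/-- The normal forms, for elements of `A^*/k^*`. -/
noncomputable def projectiveNormalForm (i j : ℤˣ) (a b : PUnits k A) : XSet k A :=
  if i = 1 then
    if j = 1 then xcl (biHom k A (a, 1)) (biHom k A (1, b⁻¹))
    else xcl (biHom k A (a, 1)) (biHom k A (b, 1) * pcl (kappa n))
  else
    if j = 1 then xcl (biHom k A (1, a⁻¹) * pcl (kappa n)) (biHom k A (1, b⁻¹))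
    else xcl (biHom k A (a, 1) * pcl (kappa n)) (biHom k A (1, b⁻¹) * pcl (kappa n))

lemma projectiveNormalForm_ucl (i j : ℤˣ) (a b : Aˣ) :
    projectiveNormalForm n i j (ucl k a) (ucl k b) = normalForm n i j a b := by
  have hl : ∀ c : Aˣ, biHom k A (ucl k c, 1) = pcl (lmul k c) := fun c => by
    rw [biHom_apply, map_one, mul_one, leftHom_ucl]
  have hr : ∀ c : Aˣ, biHom k A (1, (ucl k c)⁻¹) = pcl (rmul k c) := fun c => by
    rw [biHom_apply, map_one, one_mul, map_inv, rightHom_ucl, inv_inv]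
  simp only [projectiveNormalForm, normalForm, hl, hr, pcl_mul]

variable (hdim : Module.finrank k A = 4)
include hdim

lemma signPart_projectiveNormalForm (i j : ℤˣ) (a b : PUnits k A) :
    signPart n i j ⟨projectiveNormalForm n i j a b⟩ := by
  have h1 : ∀ z, biHom k A z ∈ PGOsign n 1 := fun z =>
    (mem_PGOsign_one_iff n hdim).mpr ⟨z, rfl⟩
  have h2 : ∀ z, biHom k A z * pcl (kappa n) ∈ PGOsign n (-1) := fun z =>
    (mem_PGOsign_neg_one_iff n hdim).mpr ⟨z, rfl⟩
  rcases Int.units_eq_one_or i with rfl | rfl <;> rcases Int.units_eq_one_or j with rfl | rfl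
  · exact ⟨_, h1 _, _, h1 _, rfl⟩
  · exact ⟨_, h1 _, _, h2 _, rfl⟩
  · exact ⟨_, h2 _, _, h1 _, rfl⟩
  · exact ⟨_, h2 _, _, h2 _, rfl⟩

variable [Algebra.IsCentral k A]

/-- The morphisms of `𝒳(A)` between normal forms. -/
lemma actsTo_projectiveNormalForm_iff (i j : ℤˣ) {φ : PGL k A} {a b a' b' : PUnits k A} :
    ActsTo n φ (projectiveNormalForm n i j a b) (projectiveNormalForm n i j a' b') ↔
      ∃ s, φ = biHom k A (s, s) ∧ a' = s * a * s⁻¹ ∧ b' = s * b * s⁻¹ := by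
  -- Inverses enter because R_b is the class (1, b⁻¹).
  have hconj : ∀ s x y : PUnits k A, x⁻¹ = s * y⁻¹ * s⁻¹ ↔ x = s * y * s⁻¹ := fun s x y => by
    rw [← inv_inj (a := x⁻¹), inv_inv]
    simp [mul_assoc]
  rcases Int.units_eq_one_or i with rfl | rfl <;> rcases Int.units_eq_one_or j with rfl | rfl
  -- In each case the trivial coordinates of the target give two equations forcing p = q = r; the
  -- other two are the conjugation relations.
  all_goals
    simp only [projectiveNormalForm, if_true, (by decide : (-1 : ℤˣ) ≠ 1), if_false,
      actsTo_xcl_iff n hdim, biHom_eq_iff, biHom_mul_kappa_eq_iff, Prod.swap_prod_mk, Prod.inv_mk,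
      Prod.mk_mul_mk, Prod.mk.injEq, mul_one]
    constructor
  · rintro ⟨p, q, r, rfl, ⟨rfl, hr⟩, hr', hb⟩
    obtain rfl := mul_inv_eq_one.mp hr.symm
    obtain rfl := mul_inv_eq_one.mp hr'.symm
    exact ⟨r, rfl, rfl, (hconj _ _ _).mp hb⟩
  · rintro ⟨s, rfl, rfl, rfl⟩
    exact ⟨s, s, s, rfl, ⟨rfl, by simp⟩, by simp, by simp [mul_assoc]⟩
  · rintro ⟨p, q, r, rfl, ⟨rfl, hr⟩, hb, hr'⟩
    obtain rfl := mul_inv_eq_one.mp hr.symm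
    obtain rfl := mul_inv_eq_one.mp hr'.symm
    exact ⟨r, rfl, rfl, hb⟩
  · rintro ⟨s, rfl, rfl, rfl⟩
    exact ⟨s, s, s, rfl, ⟨rfl, by simp⟩, by simp, by simp⟩
  · rintro ⟨p, q, r, rfl, ⟨hr, ha⟩, hr', hb⟩
    obtain rfl := mul_inv_eq_one.mp hr.symm
    obtain rfl := mul_inv_eq_one.mp hr'.symm
    exact ⟨r, rfl, (hconj _ _ _).mp ha, (hconj _ _ _).mp hb⟩
  · rintro ⟨s, rfl, rfl, rfl⟩
    exact ⟨s, s, s, rfl, ⟨by simp, by simp [mul_assoc]⟩, by simp, by simp [mul_assoc]⟩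
  · rintro ⟨p, q, r, rfl, ⟨ha, hr⟩, hr', hb⟩
    obtain rfl := mul_inv_eq_one.mp hr.symm
    obtain rfl := mul_inv_eq_one.mp hr'.symm
    exact ⟨r, rfl, ha, (hconj _ _ _).mp hb⟩
  · rintro ⟨s, rfl, rfl, rfl⟩
    exact ⟨s, s, s, rfl, ⟨rfl, by simp⟩, by simp, by simp [mul_assoc]⟩

/-- Every object of `𝒳^{c(i,j)}(A)` is isomorphic to a normal form. -/
lemma exists_actsTo_projectiveNormalForm (i j : ℤˣ) {x : XGroupoid n} (hx : signPart n i j x) :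
    ∃ φ ∈ PGOplus n, ∃ a b, ActsTo n φ x.pt (projectiveNormalForm n i j a b) := by
  obtain ⟨α, hα, β, hβ, hx⟩ := hx
  rw [hx]
  have h := fun p q => (mem_PGOplus_iff n hdim).mpr ⟨(p, q), rfl⟩
  rcases Int.units_eq_one_or i with rfl | rfl <;> rcases Int.units_eq_one_or j with rfl | rfl
  all_goals
    first
    | obtain ⟨⟨a, c⟩, rfl⟩ := (mem_PGOsign_one_iff n hdim).mp hα
    | obtain ⟨⟨a, c⟩, rfl⟩ := (mem_PGOsign_neg_one_iff n hdim).mp hα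
    first
    | obtain ⟨⟨d, b⟩, rfl⟩ := (mem_PGOsign_one_iff n hdim).mp hβ
    | obtain ⟨⟨d, b⟩, rfl⟩ := (mem_PGOsign_neg_one_iff n hdim).mp hβ
    simp only [projectiveNormalForm, if_true, (by decide : (-1 : ℤˣ) ≠ 1), if_false,
      actsTo_xcl_iff n hdim, biHom_eq_iff, biHom_mul_kappa_eq_iff, Prod.swap_prod_mk, Prod.inv_mk,
      Prod.mk_mul_mk, Prod.mk.injEq]
  -- Two coordinates have to become trivial and p, q, r are free: one of the three is set to 1 and
  -- the others are solved for.
  · exact ⟨_, h 1 (d⁻¹ * c), _, (d⁻¹ * c * b * (d⁻¹ * c)⁻¹)⁻¹, 1, d⁻¹ * c, d⁻¹, rfl,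
      ⟨rfl, by simp⟩, by simp, by simp⟩
  · exact ⟨_, h b 1, _, _, b, 1, c⁻¹, rfl, ⟨rfl, by simp⟩, rfl, by simp⟩
  · exact ⟨_, h 1 a, (d⁻¹ * c)⁻¹, (a * b * a⁻¹)⁻¹, 1, a, d⁻¹, rfl,
      ⟨by simp, by simp⟩, by simp, by simp⟩
  · exact ⟨_, h c d, _, (d * b * c⁻¹)⁻¹, c, d, 1, rfl, ⟨rfl, by simp⟩, by simp, by simp⟩

/-- The functor `ℋ^c_{i,j}`. -/
noncomputable def normalFormFunctor (i j : ℤˣ) : ZGroupoid k A ⥤ XSign n i j where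
  obj x := ⟨⟨projectiveNormalForm n i j x.back.1 x.back.2⟩,
    signPart_projectiveNormalForm n hdim i j _ _⟩
  map {x y} f := ObjectProperty.homMk ⟨⟨biHom k A (zhomElt f, zhomElt f),
      (mem_PGOplus_iff n hdim).mpr ⟨_, rfl⟩⟩,
    (actsTo_projectiveNormalForm_iff n hdim i j).mpr ⟨zhomElt f, rfl, by
      have h : ConjAct.toConjAct (zhomElt f) • x.back = y.back := f.2
      exact ⟨by rw [← h]; rfl, by rw [← h]; rfl⟩⟩⟩
  map_id x := ObjectProperty.hom_ext _ (Subtype.ext (Subtype.ext (map_one (biHom k A))))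
  map_comp f g := ObjectProperty.hom_ext _ (Subtype.ext (Subtype.ext
    (map_mul (biHom k A) (zhomElt g, zhomElt g) (zhomElt f, zhomElt f))))

lemma normalFormFunctor_isEquivalence (i j : ℤˣ) :
    (normalFormFunctor n hdim i j).IsEquivalence where
  faithful := ⟨fun {x y f g} h => by
    have h' : biHom k A (zhomElt f, zhomElt f) = biHom k A (zhomElt g, zhomElt g) :=
      congrArg (fun e : (normalFormFunctor n hdim i j).obj x ⟶ _ => homElt e.hom) h
    exact Subtype.ext (Prod.mk.inj (biHom_injective h')).1⟩
  full := ⟨fun {x y} f => by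
    obtain ⟨s, hs, h1, h2⟩ := (actsTo_projectiveNormalForm_iff n hdim i j).mp f.hom.2
    exact ⟨⟨ConjAct.toConjAct s, Prod.ext h1.symm h2.symm⟩,
      ObjectProperty.hom_ext _ (Subtype.ext (Subtype.ext hs.symm))⟩⟩
  essSurj := ⟨fun x => by
    obtain ⟨φ, hφ, a, b, h⟩ := exists_actsTo_projectiveNormalForm n hdim i j x.property
    let f : x ⟶ (normalFormFunctor n hdim i j).obj (ActionCategory.objEquiv _ _ (a, b)) :=
      ObjectProperty.homMk ⟨⟨φ, hφ⟩, h⟩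
    exact ⟨_, ⟨(ObjectProperty.isoMk _ (Groupoid.isoEquivHom _ _ |>.symm f.hom)).symm⟩⟩⟩

end Equivalence

end QuatComp

theorem proposition4p2 {k : Type*} [Field k] {A : Type*} [Ring A] [Algebra k A]
    [Algebra.IsCentral k A] [IsSimpleRing A] (hdim : Module.finrank k A = 4)
    (n : QuadraticForm k A) [QuatComp.IsHurwitzNorm n] (i j : ℤˣ) :
    ∃ H : CategoryTheory.Functor (QuatComp.ZGroupoid k A) (QuatComp.XSign n i j),
      H.IsEquivalence ∧
      (∀ a b : Aˣ, (H.obj (QuatComp.zobj k a b)).obj.pt = QuatComp.normalForm n i j a b) ∧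
      (∀ (x y : QuatComp.ZGroupoid k A) (f : x ⟶ y) (s : Aˣ),
        QuatComp.zhomElt f = QuatComp.ucl k s →
          QuatComp.homElt (H.map f).hom = QuatComp.pcl (QuatComp.innerAut k s)) := by
  refine ⟨QuatComp.normalFormFunctor n hdim i j,
    QuatComp.normalFormFunctor_isEquivalence n hdim i j,
    QuatComp.projectiveNormalForm_ucl n i j, fun x y f s hs => ?_⟩
  rw [QuatComp.pcl_innerAut, ← hs]
  rfl
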